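/- Let $F$ be a field of characteristic zero, $r\ge 1$, $m=2r$, $G=\mathbb Z^r$ (written additively, neutral element $e=0$, standard basis $\epsilon_1,\dots,\epsilon_r$). Let $\mathcal U=UT_{2r}(F)=\bigoplus_{g\in G}\mathcal U_g$ be the algebra of upper triangular matrices with the finest grading, i.e. the elementary grading induced by $(t_1,\dots,t_{2r})=(\epsilon_1,\dots,\epsilon_r,0,\epsilon_r-\epsilon_{r-1},\dots,\epsilon_r-\epsilon_1)$, in which the matrix unit $e_{ij}$ has degree $t_i-t_j$; and let $\mathcal U$ carry the symplectic involution $A\mapsto DA^{*}D^{-1}$, where $e_{ij}^{*}=e_{m+1-j,m+1-i}$ and $D=\mathrm{diag}(I_r,-I_r)$. Let $F_{G,*}\langle X\rangle$ be the free associative unital algebra on the indeterminates $x_{i,g},x_{i,g}^{*}$ ($i\in\mathbb N$, $g\in G$), graded so that $x_{i,g},x_{i,g}^*$ have degree $g$, with the involution interchanging $x_{i,g}$ and $x_{i,g}^{*}$. A polynomial is a $(G,*)$-identity of $\mathcal U$ if it vanishes whenever each $x_{i,g}$ is replaced by an element of $\mathcal U_g$ (and $x_{i,g}^*$ by its image under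 the involution); $T_{G,*}(\mathcal U)$ is the set of these identities. A $T_{G,*}$-ideal is a two-sided ideal invariant under the involution and under all endomorphisms that respect grading and involution. Let $P_n^{G,*}$ be the span of the monomials $x_{\sigma(1),g_1}^{\delta_1}\cdots x_{\sigma(n),g_n}^{\delta_n}$ with $\sigma\in S_n$, $g_i\in G$, $\delta_i\in\{\emptyset,*\}$. A monomial of $P_n^{G,*}$ can be written uniquely as $M=M_1x_{u_1,g_1}^{\delta_1}M_2x_{u_2,g_2}^{\delta_2}\cdots M_kx_{u_k,g_k}^{\delta_k}M_{k+1}$ with $g_1,\dots,g_k\ne e$ and each $M_i$ a (possibly empty) monomial in indeterminates of degree $e$. It is called good if $M\notin T_{G,*}(\mathcal U)$ and (I) the indices of the indeterminates in each $M_i$ are strictly increasing from left to right; (II) if $\dim\mathcal U_{g_i}=1$ then $\delta_i=\emptyset$ and $M_i=1$; (III) if $i<j$ and $\dim\mathcal U_{g}=1$, where $g=g_i+g_{i+1}+\cdots+g_j$, then $M_i=1$ and $u_i<u_j$. Theorem. (a) There is a finite set $N$ of monomials in $T_{G,*}(\mathcal U)$ such that $T_{G,*}(\mathcal U)$ is the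 intersection of all $T_{G,*}$-ideals containing $N$ and the polynomials $[x_{1,e},x_{2,e}]$; $x_{1,g}^{*}+x_{1,g}$ for $g\in G$ with $\dim\mathcal U_g=1$; and $x_{1,g}$ for $g\in G$ with $\mathcal U_g=0$. (b) For every $n\ge 0$, the images of the good monomials of $P_n^{G,*}$ form a basis of the vector space $P_n^{G,*}/(P_n^{G,*}\cap T_{G,*}(\mathcal U))$ (with distinct good monomials having distinct images). -/

import Mathlib

namespace GradedInvolution

/-! ### The free algebra with grading and involution -/

/-- An indeterminate `x_{i,g}` (`starred = false`) or `x_{i,g}^*` (`starred = true`), where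
`i = idx` and `g = deg`. The group `G` is written additively, with neutral element `0`. -/
structure Letter (G : Type) where
  idx : ℕ
  deg : G
  starred : Bool

section Free

variable (F : Type*) [Field F] {G : Type} [AddCommGroup G]

/-- The indeterminate `x_{i,g}` in the free algebra. -/
def x (i : ℕ) (g : G) : FreeAlgebra F (Letter G) := FreeAlgebra.ι F ⟨i, g, false⟩

/-- The indeterminate `x_{i,g}^*` in the free algebra. -/
def xs (i : ℕ) (g : G) : FreeAlgebra F (Letter G) := FreeAlgebra.ι F ⟨i, g, true⟩

/-- The monomial given by a word in the letters. -/
def mon (w : List (Letter G)) : FreeAlgebra F (Letter G) := (w.map (FreeAlgebra.ι F)).prod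

/-- The involution of the free algebra: the linear map reversing products and interchanging
`x_{i,g}` and `x_{i,g}^*`. -/
def freeInv (f : FreeAlgebra F (Letter G)) : FreeAlgebra F (Letter G) :=
  MulOpposite.unop (FreeAlgebra.lift F
    (fun l : Letter G => MulOpposite.op (FreeAlgebra.ι F (⟨l.idx, l.deg, !l.starred⟩ : Letter G))) f)

/-- The homogeneous component of degree `g` of the free algebra. -/
def freeComp (g : G) : Submodule F (FreeAlgebra F (Letter G)) :=
  Submodule.span F {f | ∃ w : List (Letter G), (w.map Letter.deg).sum = g ∧ f = mon F w}

/-- Endomorphisms of the free algebra as a graded algebra with involution. -/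
def IsGradedInvEnd (φ : FreeAlgebra F (Letter G) →ₐ[F] FreeAlgebra F (Letter G)) : Prop :=
  (∀ g : G, ∀ f ∈ freeComp F g, φ f ∈ freeComp F g) ∧ ∀ f, φ (freeInv F f) = freeInv F (φ f)

/-- Two-sided ideals of the free algebra that are invariant under the involution and under all
endomorphisms of the free algebra as a graded algebra with involution. -/
def IsTIdeal (I : TwoSidedIdeal (FreeAlgebra F (Letter G))) : Prop :=
  (∀ f ∈ I, freeInv F f ∈ I) ∧ ∀ φ, IsGradedInvEnd F φ → ∀ f ∈ I, φ f ∈ I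

/-- The intersection of all `T`-ideals that contain `S`. -/
def tIdealGen (S : Set (FreeAlgebra F (Letter G))) : Set (FreeAlgebra F (Letter G)) :=
  {f | ∀ I : TwoSidedIdeal (FreeAlgebra F (Letter G)), IsTIdeal F I → (∀ p ∈ S, p ∈ I) → f ∈ I}

/-- The word is a monomial `x_{σ(1),g_1}^{δ_1} ⋯ x_{σ(n),g_n}^{δ_n}` with `σ` a permutation of
`1, …, n`. -/
def IsMultilinear (n : ℕ) (w : List (Letter G)) : Prop :=
  (w.map Letter.idx).Perm (List.range' 1 n)

/-- The space of multilinear polynomials of degree `n`. -/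
def multilinearSpace (G : Type) (n : ℕ) : Submodule F (FreeAlgebra F (Letter G)) :=
  Submodule.span F {f | ∃ w : List (Letter G), IsMultilinear n w ∧ f = mon F w}

end Free

/-! ### Identities of a graded algebra with involution -/

section Identities

variable {F : Type*} [Field F] {G : Type} {A : Type*} [Ring A] [Algebra F A]

/-- The value of `f` under the substitution `x_{i,g} ↦ a i g`, `x_{i,g}^* ↦ (a i g)^*`. -/
def evalAt (inv : A → A) (a : ℕ → G → A) : FreeAlgebra F (Letter G) →ₐ[F] A :=
  FreeAlgebra.lift F
    (fun l : Letter G => if l.starred then inv (a l.idx l.deg) else a l.idx l.deg)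

/-- The polynomials that vanish under every substitution of elements of the component of degree
`g` for the indeterminates `x_{i,g}`. -/
def identities (comp : G → Submodule F A) (inv : A → A) :
    Submodule F (FreeAlgebra F (Letter G)) where
  carrier := {f | ∀ a : ℕ → G → A, (∀ i g, a i g ∈ comp g) → evalAt inv a f = 0}
  zero_mem' := fun a _ => map_zero _
  add_mem' := fun hf hg a ha => by rw [map_add, hf a ha, hg a ha, add_zero]
  smul_mem' := fun c f hf a ha => by rw [map_smul, hf a ha, smul_zero]

end Identities

/-! ### Upper triangular matrices -/

section UT

variable (F : Type*) [Field F]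

/-- The algebra of upper triangular `m × m` matrices. -/
def UT (m : ℕ) : Subalgebra F (Matrix (Fin m) (Fin m) F) where
  carrier := {A | A.BlockTriangular id}
  mul_mem' := fun hA hB => hA.mul hB
  add_mem' := fun hA hB => hA.add hB
  algebraMap_mem' := fun c => by
    rw [Matrix.algebraMap_eq_diagonal]
    exact Matrix.blockTriangular_diagonal _

/-- The component of degree `g` of the elementary grading induced by the tuple `t`: the span of
the matrix units `e_{ij}`, `i ≤ j`, with `t i - t j = g`. -/
def elementaryComp {G : Type} [AddCommGroup G] {m : ℕ} (t : Fin m → G) (g : G) :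
    Submodule F (UT F m) where
  carrier := {A | ∀ i j, t i - t j ≠ g → (A : Matrix (Fin m) (Fin m) F) i j = 0}
  zero_mem' := fun _ _ _ => rfl
  add_mem' := fun {A B} hA hB i j h => by
    change (A : Matrix (Fin m) (Fin m) F) i j + (B : Matrix (Fin m) (Fin m) F) i j = 0
    rw [hA i j h, hB i j h, add_zero]
  smul_mem' := fun c A hA i j h => by
    change c * (A : Matrix (Fin m) (Fin m) F) i j = 0
    rw [hA i j h, mul_zero]

/-- The vector `e_k` of `ℤ^r`, `k = 1, …, r`. -/
def stdVec (r k : ℕ) : Fin r → ℤ := fun t => if t.val + 1 = k then 1 else 0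

/-- The tuple `(e_1, …, e_r, 0, e_r - e_{r-1}, …, e_r - e_1)`. -/
def finestTuple (r : ℕ) (i : Fin (2 * r)) : Fin r → ℤ :=
  if i.val < r then stdVec r (i.val + 1) else stdVec r r - stdVec r (2 * r - i.val)

/-- The components of the finest `ℤ^r`-grading on `UT_{2r}(F)`. -/
def finestComp (r : ℕ) (g : Fin r → ℤ) : Submodule F (UT F (2 * r)) :=
  elementaryComp F (finestTuple r) g

/-- The reflection involution, `e_{ij} ↦ e_{m+1-j,m+1-i}`. -/
def reflection {m : ℕ} (A : UT F m) : UT F m :=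
  ⟨Matrix.of fun i j => (A : Matrix (Fin m) (Fin m) F) j.rev i.rev,
    fun _ _ h => A.2 (Fin.rev_lt_rev.mpr h)⟩

/-- The diagonal matrix with diagonal blocks `I_r` and `-I_r`. -/
def signMatrix (r : ℕ) : Matrix (Fin (2 * r)) (Fin (2 * r)) F :=
  Matrix.diagonal fun i => if i.val < r then 1 else -1

/-- The symplectic involution `A ↦ D A^* D⁻¹`. -/
noncomputable def symplectic {r : ℕ} (A : UT F (2 * r)) : UT F (2 * r) :=
  ⟨signMatrix F r * (reflection F A : Matrix (Fin (2 * r)) (Fin (2 * r)) F) * (signMatrix F r)⁻¹, by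
    have hA : (reflection F A : Matrix (Fin (2 * r)) (Fin (2 * r)) F).BlockTriangular id :=
      (reflection F A).2
    have h1 : (signMatrix F r).BlockTriangular id := Matrix.blockTriangular_diagonal _
    have h2 : ((signMatrix F r)⁻¹).BlockTriangular id := by
      rw [signMatrix, Matrix.inv_diagonal]
      exact Matrix.blockTriangular_diagonal _
    exact (h1.mul hA).mul h2⟩

/-- The identities of `UT_{2r}(F)` with the finest grading and the symplectic involution. -/
noncomputable def sympIdentities (r : ℕ) :
    Submodule F (FreeAlgebra F (Letter (Fin r → ℤ))) :=
  identities (finestComp F r) (symplectic F)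

/-! ### Good monomials -/

/-- The word `M_1 y_1 M_2 y_2 ⋯ M_k y_k M_{k+1}` (indices start from `0` in the code). -/
def assemble {G : Type} {k : ℕ} (M : Fin (k + 1) → List (Letter G)) (y : Fin k → Letter G) :
    List (Letter G) :=
  (List.ofFn fun i : Fin k => M i.castSucc ++ [y i]).flatten ++ M (Fin.last k)

/-- Good monomials of degree `n` for `UT_{2r}(F)`. Here the `y_i` are the letters of non-neutral
degree and the `M_i` are words in letters of neutral degree. -/
def IsGood (r n : ℕ) (w : List (Letter (Fin r → ℤ))) : Prop :=
  IsMultilinear n w ∧ mon F w ∉ sympIdentities F r ∧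
  ∃ (k : ℕ) (M : Fin (k + 1) → List (Letter (Fin r → ℤ))) (y : Fin k → Letter (Fin r → ℤ)),
    w = assemble M y ∧
    (∀ i, ∀ l ∈ M i, l.deg = 0) ∧
    (∀ i, (y i).deg ≠ 0) ∧
    (∀ i, (M i).Pairwise fun l l' => l.idx < l'.idx) ∧
    (∀ i, Module.finrank F (finestComp F r (y i).deg) = 1 →
      (y i).starred = false ∧ M i.castSucc = []) ∧
    (∀ i j, i < j → Module.finrank F (finestComp F r (∑ l ∈ Finset.Icc i j, (y l).deg)) = 1 →
      M i.castSucc = [] ∧ (y i).idx < (y j).idx)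

/-- The quotient of the multilinear polynomials of degree `n` by the identities among them. -/
abbrev multilinearQuotient (r n : ℕ) : Type _ :=
  multilinearSpace F (Fin r → ℤ) n ⧸
    (sympIdentities F r).submoduleOf (multilinearSpace F (Fin r → ℤ) n)

/-- The image of a good monomial in the multilinear quotient. -/
noncomputable def goodClass {r n : ℕ} (w : {w : List (Letter (Fin r → ℤ)) // IsGood F r n w}) :
    multilinearQuotient F r n :=
  Submodule.Quotient.mk ⟨mon F w.1, Submodule.subset_span ⟨w.1, w.2.1, rfl⟩⟩

end UT

end GradedInvolution

/-! Matrix products are read as walks on the vertices 1, …, 2r. Since `finestTuple` t is injective,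
a letter of degree g leads from a vertex p to at most one vertex q ≥ p, the one with t p - t q = g.
A monomial can be nonzero at the entry (p, q) only if its letters spell a walk from p to q.
Conversely, a word with distinct indices that spells a walk is not an identity, because the matrix
units of the walk can be substituted letter by letter (`notMem_of_walk`). The sum t p + t p.rev does
not depend on p, so the involution preserves degrees and reflects the edge (p, q) to (q.rev, p.rev).
The one-dimensional components are exactly those spanned by some e_{p,p.rev}, and there the
involution is -1.

Spanning: modulo a T-ideal containing the basic identities, neutral letters commute, a word whose
degree has a one-dimensional component is minus its image under the involution, and hence d z ≡ z
d^* for d neutral and z of such a degree. Every violation of goodness thus allows a rewriting into a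
smaller word for a well-founded order (`locallyGood_of_minimal`, `exists_good_mon_sub_mem`).

Independence: two good words that spell walks from p to q with the same matrix units attached to
their indices are equal (`LocallyGood.unique`). The substitution read off a walk of a good word
therefore kills, at the entry (p, q), all other good words of the same degree
(`goodMon_independent`). Both arguments use goodness as a condition on contiguous subwords
(`isGood_iff`).

Together they put every multilinear identity into the T-ideal once the monomial ones are there.
Finitely many of these suffice, since each non-neutral letter strictly raises the vertex and only
the first 2r such letters matter (`mon_mem_of_mem_sympIdentities`). Polarization in characteristic
zero reduces all identities to multilinear ones (`mem_of_multilinear_mem`). -/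

namespace GradedInvolution

/-! ### The symplectic involution on matrices. -/

section Matrices

variable {F : Type*} [Field F] {r : ℕ}

/-- The diagonal entries of `signMatrix`. -/
def sgn (F : Type*) [Field F] {r : ℕ} (i : Fin (2 * r)) : F := if i.val < r then 1 else -1

theorem sgn_mul_self (i : Fin (2 * r)) : sgn F i * sgn F i = 1 := by
  unfold sgn; split_ifs <;> simp

theorem sgn_ne_zero (i : Fin (2 * r)) : sgn F i ≠ 0 := by
  unfold sgn; split_ifs <;> simp

theorem sgn_rev (i : Fin (2 * r)) : sgn F i.rev = - sgn F i := by
  have h1 := i.2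
  have h2 := Fin.val_rev i
  unfold sgn
  split_ifs <;> first | omega | simp

theorem signMatrix_inv : (signMatrix F r)⁻¹ = signMatrix F r := by
  apply Matrix.inv_eq_right_inv
  rw [signMatrix, Matrix.diagonal_mul_diagonal, ← Matrix.diagonal_one]
  congr 1
  funext i
  exact sgn_mul_self i

theorem symplectic_apply (A : UT F (2 * r)) (i j : Fin (2 * r)) :
    (symplectic F A : Matrix (Fin (2 * r)) (Fin (2 * r)) F) i j =
      sgn F i * (A : Matrix (Fin (2 * r)) (Fin (2 * r)) F) j.rev i.rev * sgn F j := by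
  change (signMatrix F r * (reflection F A : Matrix (Fin (2 * r)) (Fin (2 * r)) F) *
    (signMatrix F r)⁻¹) i j = _
  rw [signMatrix_inv, signMatrix, Matrix.mul_diagonal, Matrix.diagonal_mul]
  rfl

theorem UT.ext' {m : ℕ} {A B : UT F m}
    (h : ∀ i j, (A : Matrix (Fin m) (Fin m) F) i j = (B : Matrix (Fin m) (Fin m) F) i j) :
    A = B :=
  Subtype.ext (Matrix.ext h)

theorem symplectic_add (A B : UT F (2 * r)) :
    symplectic F (A + B) = symplectic F A + symplectic F B := by
  refine UT.ext' fun i j => ?_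
  have h : ∀ (C D : UT F (2 * r)) (i j : Fin (2 * r)),
    ((C + D : UT F (2 * r)) : Matrix (Fin (2 * r)) (Fin (2 * r)) F) i j =
    (C : Matrix _ _ F) i j + (D : Matrix _ _ F) i j := fun _ _ _ _ => rfl
  simp only [symplectic_apply, h]
  ring

theorem symplectic_smul (c : F) (A : UT F (2 * r)) :
    symplectic F (c • A) = c • symplectic F A := by
  refine UT.ext' fun i j => ?_
  have h : ∀ (C : UT F (2 * r)) (i j : Fin (2 * r)),
    ((c • C : UT F (2 * r)) : Matrix (Fin (2 * r)) (Fin (2 * r)) F) i j =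
    c * (C : Matrix _ _ F) i j := fun _ _ _ => rfl
  simp only [symplectic_apply, h]
  ring

theorem symplectic_zero : symplectic F (0 : UT F (2 * r)) = 0 := by
  have := symplectic_smul (0 : F) (0 : UT F (2 * r))
  simpa using this

theorem symplectic_one : symplectic F (1 : UT F (2 * r)) = 1 := by
  refine UT.ext' fun i j => ?_
  have h : ∀ i j : Fin (2 * r),
    ((1 : UT F (2 * r)) : Matrix (Fin (2 * r)) (Fin (2 * r)) F) i j = if i = j then 1 else 0 :=
    fun i j => Matrix.one_apply
  simp only [symplectic_apply, h]
  by_cases hij : i = j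
  · subst hij; simp [sgn_mul_self]
  · have : ¬ j.rev = i.rev := fun h => hij (Fin.rev_injective h).symm
    simp [hij, this]

theorem UT.mul_apply' {m : ℕ} (A B : UT F m) (i j : Fin m) :
    ((A * B : UT F m) : Matrix (Fin m) (Fin m) F) i j =
      ∑ k, (A : Matrix (Fin m) (Fin m) F) i k * (B : Matrix (Fin m) (Fin m) F) k j :=
  Matrix.mul_apply

theorem symplectic_mul (A B : UT F (2 * r)) :
    symplectic F (A * B) = symplectic F B * symplectic F A := by
  refine UT.ext' fun i j => ?_
  simp only [symplectic_apply, UT.mul_apply']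
  rw [Finset.mul_sum, Finset.sum_mul, ← Equiv.sum_comp Fin.revPerm]
  refine Finset.sum_congr rfl fun k _ => ?_
  have := sgn_mul_self (F := F) k
  simp only [Fin.revPerm_apply]
  linear_combination (-(sgn F i * (A : Matrix _ _ F) j.rev k.rev * (B : Matrix _ _ F) k.rev i.rev *
    sgn F j)) * this

theorem symplectic_symplectic (A : UT F (2 * r)) : symplectic F (symplectic F A) = A := by
  refine UT.ext' fun i j => ?_
  simp only [symplectic_apply, Fin.rev_rev, sgn_rev]
  linear_combination ((A : Matrix _ _ F) i j) * ((sgn F i * sgn F i) * sgn_mul_self (F := F) j +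
    sgn_mul_self (F := F) i)

end Matrices

/-! ### Arithmetic of the tuple that induces the finest grading. -/

section Tuple

variable {r : ℕ}

theorem finestTuple_apply (i : Fin (2 * r)) (k : Fin r) :
    finestTuple r i k = if i.val < r then (if k.val = i.val then 1 else 0)
      else (if k.val + 1 = r then 1 else 0) - (if k.val + 1 + i.val = 2 * r then 1 else 0) := by
  have := i.2
  unfold finestTuple stdVec
  by_cases h : i.val < r
  · simp [h]
  · have h1 : k.val + 1 = 2 * r - i.val ↔ k.val + 1 + i.val = 2 * r := by omega
    simp [h, h1]

/-- The constant value of this sum is the last basis vector. This is why the reflection of an entry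
(i, j) to (j.rev, i.rev) preserves the degree. -/
theorem finestTuple_add_rev_apply (i : Fin (2 * r)) (k : Fin r) :
    finestTuple r i k + finestTuple r i.rev k = if k.val + 1 = r then 1 else 0 := by
  have h1 := i.2
  have h2 := Fin.val_rev i
  have h5 := k.2
  rw [finestTuple_apply, finestTuple_apply]
  by_cases h : i.val < r
  · rw [if_pos h, if_neg (show ¬ i.rev.val < r by omega)]
    split_ifs <;> omega
  · rw [if_neg h, if_pos (show i.rev.val < r by omega)]
    split_ifs <;> omega

theorem finestTuple_add_rev (i j : Fin (2 * r)) :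
    finestTuple r i + finestTuple r i.rev = finestTuple r j + finestTuple r j.rev := by
  funext k
  rw [Pi.add_apply, Pi.add_apply, finestTuple_add_rev_apply, finestTuple_add_rev_apply]

theorem finestTuple_sub_rev (i j : Fin (2 * r)) :
    finestTuple r j.rev - finestTuple r i.rev = finestTuple r i - finestTuple r j := by
  have := finestTuple_add_rev i j
  linear_combination (exp := 1) -this

theorem finestTuple_injective : Function.Injective (finestTuple r) := by
  intro i j h
  have hi := i.2
  have hj := j.2
  have key : ∀ k : Fin r, _ := fun k => congrFun h k
  simp only [finestTuple_apply] at key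
  ext
  by_contra hne
  by_cases h1 : i.val < r
  · have := key ⟨i.val, h1⟩
    by_cases h2 : j.val < r
    · simp only [h1, h2] at this
      split_ifs at this <;> omega
    · have h3 := key ⟨2 * r - 1 - j.val, by omega⟩
      simp only [h1, h2, if_true, if_false] at this h3
      split_ifs at this h3 <;> omega
  · by_cases h2 : j.val < r
    · have := key ⟨j.val, h2⟩
      have h3 := key ⟨2 * r - 1 - i.val, by omega⟩
      simp only [h1, h2, if_true, if_false] at this h3
      split_ifs at this h3 <;> omega
    · have h3 := key ⟨2 * r - 1 - i.val, by omega⟩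
      simp only [h1, h2, if_false] at h3
      split_ifs at h3 <;> omega

/-- Coordinate a of the right side is 2, and no coordinate of the tuple exceeds 1, so both summands
have a 1 there. If i ≠ a, this forces a to be the last coordinate and i to lie in the second half,
where t i also has a coordinate -1; cancelling it would require two coordinates 1 in t j. -/
theorem finestTuple_add_eq {a i j : Fin (2 * r)} (ha : a.val < r)
    (h : finestTuple r i + finestTuple r j = finestTuple r a + finestTuple r a) : i = a := by
  have hi := i.2
  have hj := j.2
  have key : ∀ k : Fin r, _ := fun k => congrFun h k
  simp only [Pi.add_apply, finestTuple_apply, ha, if_true] at key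
  ext
  by_contra hne
  have h0 := key ⟨a.val, ha⟩
  simp only at h0
  by_cases h1 : i.val < r
  · simp only [h1, if_true] at h0
    split_ifs at h0 <;> omega
  · have h2 := key ⟨2 * r - 1 - i.val, by omega⟩
    simp only [h1, if_false] at h0 h2
    split_ifs at h0 h2 <;> omega

/-- Reflecting j turns the difference into the sum t i + t j.rev = 2 t a. Hence the degree of an
antidiagonal entry is shared by no other entry. -/
theorem eq_of_sub_eq {a i j : Fin (2 * r)} (ha : a < a.rev)
    (h : finestTuple r i - finestTuple r j = finestTuple r a - finestTuple r a.rev) :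
    i = a ∧ j = a.rev := by
  have ha' : a.val < r := by
    have h1 := Fin.val_rev a
    have h2 : a.val < a.rev.val := ha
    omega
  have h1 : finestTuple r i + finestTuple r j.rev = finestTuple r a + finestTuple r a := by
    have := finestTuple_add_rev j a
    linear_combination (exp := 1) this + h
  have h2 : finestTuple r j.rev + finestTuple r i = finestTuple r a + finestTuple r a := by
    rw [add_comm, h1]
  refine ⟨finestTuple_add_eq ha' h1, ?_⟩
  rw [← finestTuple_add_eq ha' h2, Fin.rev_rev]

end Tuple

/-! ### Homogeneous components; the one-dimensional ones are antidiagonal. -/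

section Components

variable {F : Type*} [Field F] {r : ℕ}

/-- The matrix unit `e_{ij}` as an upper triangular matrix. -/
def unit (F : Type*) [Field F] {m : ℕ} (i j : Fin m) (h : i ≤ j) : UT F m :=
  ⟨Matrix.single i j 1, by
    intro a b hab
    simp only [id] at hab
    rw [Matrix.single_apply, if_neg]
    rintro ⟨rfl, rfl⟩
    exact absurd h (not_le.mpr hab)⟩

theorem unit_apply {m : ℕ} (i j : Fin m) (h : i ≤ j) (a b : Fin m) :
    (unit F i j h : Matrix (Fin m) (Fin m) F) a b = if i = a ∧ j = b then 1 else 0 :=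
  Matrix.single_apply ..

theorem unit_mem {g : Fin r → ℤ} (i j : Fin (2 * r)) (h : i ≤ j)
    (hg : finestTuple r i - finestTuple r j = g) : unit F i j h ∈ finestComp F r g := by
  intro a b hab
  rw [unit_apply, if_neg]
  rintro ⟨rfl, rfl⟩
  exact hab hg

theorem symplectic_mem {g : Fin r → ℤ} {A : UT F (2 * r)} (hA : A ∈ finestComp F r g) :
    symplectic F A ∈ finestComp F r g := by
  intro i j hij
  rw [symplectic_apply, hA, mul_zero, zero_mul]
  rwa [finestTuple_sub_rev]

instance finestComp_free (g : Fin r → ℤ) : Module.Free F (finestComp F r g) :=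
  @Module.Free.of_divisionRing F (finestComp F r g) _ (finestComp F r g).addCommGroup _

/-- The unit e_{ij} and its reflection lie in the same component and would be linearly independent
if they were distinct. -/
theorem eq_rev_of_finrank_eq_one {g : Fin r → ℤ} (hg : Module.finrank F (finestComp F r g) = 1)
    {i j : Fin (2 * r)} (hij : i ≤ j) (h : finestTuple r i - finestTuple r j = g) :
    j = i.rev := by
  by_contra hne
  obtain ⟨v, -, hv⟩ := (finrank_eq_one_iff' (K := F) (V := finestComp F r g)).mp hg
  obtain ⟨c, hc⟩ := hv ⟨unit F i j hij, unit_mem i j hij h⟩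
  obtain ⟨d, hd⟩ := hv ⟨unit F j.rev i.rev (Fin.rev_le_rev.mpr hij),
    unit_mem _ _ _ (by rw [finestTuple_sub_rev, h])⟩
  have e : ∀ (c : F) (A : finestComp F r g) (B : UT F (2 * r)) (hB), c • A = ⟨B, hB⟩ →
      ∀ a b : Fin (2 * r), c * (A.1 : Matrix (Fin (2 * r)) (Fin (2 * r)) F) a b =
        (B : Matrix (Fin (2 * r)) (Fin (2 * r)) F) a b := by
    intro c A B hB h a b
    have : (c • A).1 = B := by rw [h]
    rw [← this]; rfl
  have h1 := e c v _ _ hc i j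
  have h2 := e d v _ _ hd i j
  have h3 := e d v _ _ hd j.rev i.rev
  rw [unit_apply, if_pos ⟨rfl, rfl⟩] at h1 h3
  rw [unit_apply, if_neg] at h2
  · rcases mul_eq_zero.mp h2 with h4 | h4
    · simp [h4] at h3
    · simp [h4] at h1
  · rintro ⟨h4, h5⟩
    exact hne (by rw [← h4, Fin.rev_rev])

theorem finrank_zero_ne_one (hr : 1 ≤ r) : Module.finrank F (finestComp F r 0) ≠ 1 := by
  intro h
  have := eq_rev_of_finrank_eq_one h (le_refl (⟨0, by omega⟩ : Fin (2 * r))) (sub_self _)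
  have h2 := congrArg Fin.val this
  rw [Fin.val_rev] at h2
  simp only at h2
  omega

theorem finrank_sub_rev {a : Fin (2 * r)} (ha : a < a.rev) :
    Module.finrank F (finestComp F r (finestTuple r a - finestTuple r a.rev)) = 1 := by
  rw [finrank_eq_one_iff' (K := F) (V := finestComp F r _)]
  refine ⟨⟨unit F a a.rev ha.le, unit_mem _ _ _ rfl⟩, ?_, ?_⟩
  · intro h
    have h1 : unit F a a.rev ha.le = 0 := congrArg Subtype.val h
    have h2 : (unit F a a.rev ha.le : Matrix _ _ F) a a.rev = 0 := by rw [h1]; rfl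
    rw [unit_apply] at h2
    simp at h2
  · rintro ⟨A, hA⟩
    refine ⟨(A : Matrix _ _ F) a a.rev, Subtype.ext (UT.ext' fun i j => ?_)⟩
    change (A : Matrix _ _ F) a a.rev * (unit F a a.rev ha.le : Matrix _ _ F) i j =
      (A : Matrix _ _ F) i j
    rw [unit_apply]
    split_ifs with h
    · obtain ⟨rfl, rfl⟩ := h
      rw [mul_one]
    · rw [mul_zero, hA]
      intro h'
      obtain ⟨h1, h2⟩ := eq_of_sub_eq ha h'
      exact h ⟨h1.symm, h2.symm⟩

/-- Only antidiagonal entries survive. The reflection fixes them, and conjugation by D contributes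
the product of the signs at i and i.rev, which is -1. -/
theorem symplectic_eq_neg {g : Fin r → ℤ} (hg : Module.finrank F (finestComp F r g) = 1)
    {A : UT F (2 * r)} (hA : A ∈ finestComp F r g) : symplectic F A + A = 0 := by
  refine UT.ext' fun i j => ?_
  change (symplectic F A : Matrix _ _ F) i j + (A : Matrix _ _ F) i j = 0
  rw [symplectic_apply]
  by_cases hij : i ≤ j
  · by_cases h : finestTuple r i - finestTuple r j = g
    · have := eq_rev_of_finrank_eq_one hg hij h
      subst this
      rw [Fin.rev_rev, sgn_rev]
      linear_combination (-(A : Matrix _ _ F) i i.rev) * sgn_mul_self (F := F) i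
    · rw [hA i j h, hA _ _ (by rwa [finestTuple_sub_rev])]
      simp
  · have h1 : (A : Matrix _ _ F) i j = 0 := A.2 (not_le.mp hij)
    have h2 : (A : Matrix _ _ F) j.rev i.rev = 0 := A.2 (Fin.rev_lt_rev.mpr (not_le.mp hij))
    rw [h1, h2]
    simp

theorem mul_comm_of_mem_zero {A B : UT F (2 * r)} (hA : A ∈ finestComp F r 0)
    (hB : B ∈ finestComp F r 0) : A * B = B * A := by
  have hd : ∀ {A : UT F (2 * r)}, A ∈ finestComp F r 0 → ∀ i j, i ≠ j →
      (A : Matrix _ _ F) i j = 0 := fun hA i j h =>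
    hA i j fun h' => h (finestTuple_injective (sub_eq_zero.mp h'))
  refine UT.ext' fun i j => ?_
  rw [UT.mul_apply', UT.mul_apply']
  by_cases hij : i = j
  · subst hij
    rw [Finset.sum_eq_single i, Finset.sum_eq_single i, mul_comm]
    · intro k _ hk; rw [hd hB i k hk.symm, zero_mul]
    · simp
    · intro k _ hk; rw [hd hA i k hk.symm, zero_mul]
    · simp
  · rw [Finset.sum_eq_zero, Finset.sum_eq_zero]
    · intro k _
      by_cases hk : i = k
      · subst hk; rw [hd hA i j hij, mul_zero]
      · rw [hd hB i k hk, zero_mul]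
    · intro k _
      by_cases hk : i = k
      · subst hk; rw [hd hB i j hij, mul_zero]
      · rw [hd hA i k hk, zero_mul]

theorem mul_mem_finestComp {g h : Fin r → ℤ} {A B : UT F (2 * r)} (hA : A ∈ finestComp F r g)
    (hB : B ∈ finestComp F r h) : A * B ∈ finestComp F r (g + h) := by
  intro i j hij
  rw [UT.mul_apply']
  refine Finset.sum_eq_zero fun k _ => ?_
  by_cases h1 : finestTuple r i - finestTuple r k = g
  · rw [hB k j, mul_zero]
    rintro h2
    exact hij (by rw [← h1, ← h2, sub_add_sub_cancel])
  · rw [hA i k h1, zero_mul]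

theorem one_mem_finestComp : (1 : UT F (2 * r)) ∈ finestComp F r 0 := by
  intro i j hij
  refine Matrix.one_apply_ne ?_
  rintro rfl
  exact hij (sub_self _)

end Components

/-! ### Monomials, degrees and substitutions in the free algebra. -/

section Words

variable {F : Type*} [Field F] {G : Type}

/-- The involution on letters. -/
def Letter.star (l : Letter G) : Letter G := ⟨l.idx, l.deg, !l.starred⟩

@[simp] theorem Letter.star_idx (l : Letter G) : l.star.idx = l.idx := rfl
@[simp] theorem Letter.star_deg (l : Letter G) : l.star.deg = l.deg := rfl
@[simp] theorem Letter.star_starred (l : Letter G) : l.star.starred = !l.starred := rfl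
@[simp] theorem Letter.star_star (l : Letter G) : l.star.star = l := by
  cases l; simp [Letter.star]

/-- The involution on words. -/
def wordInv (w : List (Letter G)) : List (Letter G) := (w.map Letter.star).reverse

@[simp] theorem mon_nil : mon F ([] : List (Letter G)) = 1 := rfl
theorem mon_cons (l : Letter G) (w : List (Letter G)) :
    mon F (l :: w) = FreeAlgebra.ι F l * mon F w := by simp [mon]
theorem mon_append (u w : List (Letter G)) : mon F (u ++ w) = mon F u * mon F w := by
  simp [mon]
theorem mon_singleton (l : Letter G) : mon F [l] = FreeAlgebra.ι F l := by simp [mon]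

theorem freeInv_mul (f g : FreeAlgebra F (Letter G)) :
    freeInv F (f * g) = freeInv F g * freeInv F f := by simp [freeInv]
theorem freeInv_one : freeInv F (1 : FreeAlgebra F (Letter G)) = 1 := by simp [freeInv]
theorem freeInv_add (f g : FreeAlgebra F (Letter G)) :
    freeInv F (f + g) = freeInv F f + freeInv F g := by simp [freeInv]
theorem freeInv_smul (c : F) (f : FreeAlgebra F (Letter G)) :
    freeInv F (c • f) = c • freeInv F f := by simp [freeInv]
theorem freeInv_ι (l : Letter G) :
    freeInv F (FreeAlgebra.ι F l) = FreeAlgebra.ι F l.star := by simp [freeInv, Letter.star]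

theorem freeInv_mon (w : List (Letter G)) : freeInv F (mon F w) = mon F (wordInv w) := by
  induction w with
  | nil => exact freeInv_one
  | cons l w ih =>
    rw [mon_cons, freeInv_mul, ih, freeInv_ι, wordInv, wordInv, List.map_cons,
      List.reverse_cons, mon_append, mon_singleton]

theorem span_mon : Submodule.span F (Set.range (mon F (G := G))) = ⊤ := by
  rw [eq_top_iff]
  rintro f -
  induction f using FreeAlgebra.induction with
  | grade0 c =>
    rw [Algebra.algebraMap_eq_smul_one]
    exact Submodule.smul_mem _ _ (Submodule.subset_span ⟨[], rfl⟩)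
  | grade1 l => exact Submodule.subset_span ⟨[l], mon_singleton l⟩
  | mul f g hf hg =>
    have := Submodule.mul_mem_mul hf hg
    rw [Submodule.span_mul_span] at this
    refine Submodule.span_mono ?_ this
    rintro _ ⟨_, ⟨u, rfl⟩, _, ⟨w, rfl⟩, rfl⟩
    exact ⟨u ++ w, mon_append u w⟩
  | add f g hf hg => exact Submodule.add_mem _ hf hg

theorem freeAlgebra_induction {P : FreeAlgebra F (Letter G) → Prop} (f : FreeAlgebra F (Letter G))
    (hmon : ∀ w, P (mon F w)) (hzero : P 0) (hadd : ∀ f g, P f → P g → P (f + g))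
    (hsmul : ∀ (c : F) f, P f → P (c • f)) : P f := by
  have hf : f ∈ Submodule.span F (Set.range (mon F (G := G))) := by rw [span_mon]; trivial
  induction hf using Submodule.span_induction with
  | mem f hf => obtain ⟨w, rfl⟩ := hf; exact hmon w
  | zero => exact hzero
  | add f g _ _ hf hg => exact hadd f g hf hg
  | smul c f _ hf => exact hsmul c f hf

theorem freeInv_freeInv (f : FreeAlgebra F (Letter G)) : freeInv F (freeInv F f) = f := by
  induction f using freeAlgebra_induction with
  | hmon w =>
    rw [freeInv_mon, freeInv_mon]
    simp [wordInv, List.map_reverse, Function.comp_def]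
  | hzero => simp [freeInv]
  | hadd f g hf hg => rw [freeInv_add, freeInv_add, hf, hg]
  | hsmul c f hf => rw [freeInv_smul, freeInv_smul, hf]

/-- The endomorphism `x_{i,g} ↦ p i g` commuting with the involution. -/
def subst (p : ℕ → G → FreeAlgebra F (Letter G)) :
    FreeAlgebra F (Letter G) →ₐ[F] FreeAlgebra F (Letter G) :=
  evalAt (freeInv F) p

theorem subst_ι (p : ℕ → G → FreeAlgebra F (Letter G)) (l : Letter G) :
    subst p (FreeAlgebra.ι F l) =
      if l.starred then freeInv F (p l.idx l.deg) else p l.idx l.deg := by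
  simp [subst, evalAt]

variable [AddCommGroup G]

/-- The degree of a word. -/
def wdeg (w : List (Letter G)) : G := (w.map Letter.deg).sum

@[simp] theorem wdeg_nil : wdeg ([] : List (Letter G)) = 0 := rfl
@[simp] theorem wdeg_cons (l : Letter G) (w : List (Letter G)) :
    wdeg (l :: w) = l.deg + wdeg w := by simp [wdeg]
@[simp] theorem wdeg_append (u w : List (Letter G)) : wdeg (u ++ w) = wdeg u + wdeg w := by
  simp [wdeg]

theorem wdeg_eq_zero {w : List (Letter G)} (h : ∀ l ∈ w, l.deg = 0) : wdeg w = 0 := by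
  refine List.sum_eq_zero fun g hg => ?_
  obtain ⟨l, hl, rfl⟩ := List.mem_map.mp hg
  exact h l hl

theorem wdeg_wordInv (w : List (Letter G)) : wdeg (wordInv w) = wdeg w := by
  simp [wdeg, wordInv, List.map_reverse, Function.comp_def]

theorem mon_mem_freeComp (w : List (Letter G)) : mon F w ∈ freeComp F (wdeg w) :=
  Submodule.subset_span ⟨w, rfl, rfl⟩

theorem ι_mem_freeComp (l : Letter G) : FreeAlgebra.ι F l ∈ freeComp F l.deg := by
  have := mon_mem_freeComp (F := F) [l]
  rwa [wdeg_cons, wdeg_nil, add_zero, mon_singleton] at this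

theorem mul_mem_freeComp {g h : G} {p q : FreeAlgebra F (Letter G)} (hp : p ∈ freeComp F g)
    (hq : q ∈ freeComp F h) : p * q ∈ freeComp F (g + h) := by
  have := Submodule.mul_mem_mul hp hq
  rw [freeComp, freeComp, Submodule.span_mul_span] at this
  refine Submodule.span_mono ?_ this
  rintro _ ⟨_, ⟨u, rfl, rfl⟩, _, ⟨w, rfl, rfl⟩, rfl⟩
  exact ⟨u ++ w, wdeg_append u w, (mon_append u w).symm⟩

theorem freeInv_mem_freeComp {g : G} {p : FreeAlgebra F (Letter G)} (hp : p ∈ freeComp F g) :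
    freeInv F p ∈ freeComp F g := by
  induction hp using Submodule.span_induction with
  | mem f hf =>
    obtain ⟨w, rfl, rfl⟩ := hf
    rw [freeInv_mon]
    exact Submodule.subset_span ⟨_, wdeg_wordInv w, rfl⟩
  | zero => simp [freeInv]
  | add f g _ _ hf hg => rw [freeInv_add]; exact Submodule.add_mem _ hf hg
  | smul c f _ hf => rw [freeInv_smul]; exact Submodule.smul_mem _ _ hf

theorem isGradedInvEnd_subst {p : ℕ → G → FreeAlgebra F (Letter G)}
    (hp : ∀ i g, p i g ∈ freeComp F g) : IsGradedInvEnd F (subst p) := by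
  have hι : ∀ l : Letter G, subst p (FreeAlgebra.ι F l) ∈ freeComp F l.deg := fun l => by
    rw [subst_ι]
    split_ifs
    · exact freeInv_mem_freeComp (hp _ _)
    · exact hp _ _
  have hmon : ∀ w : List (Letter G), subst p (mon F w) ∈ freeComp F (wdeg w) := fun w => by
    induction w with
    | nil => rw [mon_nil, map_one]; exact mon_mem_freeComp []
    | cons l w ih =>
      rw [mon_cons, map_mul, wdeg_cons]
      exact mul_mem_freeComp (hι l) ih
  constructor
  · intro g f hf
    induction hf using Submodule.span_induction with
    | mem f hf => obtain ⟨w, rfl, rfl⟩ := hf; exact hmon w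
    | zero => rw [map_zero]; exact Submodule.zero_mem _
    | add f g _ _ hf hg => rw [map_add]; exact Submodule.add_mem _ hf hg
    | smul c f _ hf => rw [map_smul]; exact Submodule.smul_mem _ _ hf
  · intro f
    induction f using freeAlgebra_induction with
    | hmon w =>
      induction w with
      | nil => rw [mon_nil, freeInv_one, map_one, freeInv_one]
      | cons l w ih =>
        rw [mon_cons, freeInv_mul, map_mul, ih, map_mul, freeInv_mul]
        congr 1
        rw [freeInv_ι, subst_ι, subst_ι]
        cases h : l.starred <;> simp [h, freeInv_freeInv]
    | hzero => simp [freeInv]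
    | hadd f g hf hg => rw [freeInv_add, map_add, map_add, freeInv_add, hf, hg]
    | hsmul c f hf => rw [freeInv_smul, map_smul, map_smul, freeInv_smul, hf]

end Words

/-! ### The identities form a T-ideal that contains the basic ones. -/

section Identities

variable {F : Type*} [Field F] {r : ℕ}

theorem evalAt_ι {G : Type} {A : Type*} [Ring A] [Algebra F A] (inv : A → A) (a : ℕ → G → A)
    (l : Letter G) : evalAt (F := F) inv a (FreeAlgebra.ι F l) =
      if l.starred then inv (a l.idx l.deg) else a l.idx l.deg := by
  simp [evalAt]

theorem evalAt_freeInv (a : ℕ → (Fin r → ℤ) → UT F (2 * r))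
    (f : FreeAlgebra F (Letter (Fin r → ℤ))) :
    evalAt (symplectic F) a (freeInv F f) = symplectic F (evalAt (symplectic F) a f) := by
  induction f using freeAlgebra_induction with
  | hmon w =>
    induction w with
    | nil => rw [mon_nil, freeInv_one, map_one, symplectic_one]
    | cons l w ih =>
      rw [mon_cons, freeInv_mul, map_mul, ih, map_mul, symplectic_mul]
      congr 1
      rw [freeInv_ι, evalAt_ι, evalAt_ι]
      cases h : l.starred <;> simp [h, symplectic_symplectic]
  | hzero => simp [freeInv, symplectic_zero]
  | hadd f g hf hg => rw [freeInv_add, map_add, map_add, hf, hg, symplectic_add]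
  | hsmul c f hf => rw [freeInv_smul, map_smul, map_smul, hf, symplectic_smul]

theorem evalAt_mem {a : ℕ → (Fin r → ℤ) → UT F (2 * r)} (ha : ∀ i g, a i g ∈ finestComp F r g)
    {g : Fin r → ℤ} {f : FreeAlgebra F (Letter (Fin r → ℤ))} (hf : f ∈ freeComp F g) :
    evalAt (symplectic F) a f ∈ finestComp F r g := by
  induction hf using Submodule.span_induction with
  | mem f hf =>
    obtain ⟨w, rfl, rfl⟩ := hf
    induction w with
    | nil => rw [mon_nil, map_one]; exact one_mem_finestComp
    | cons l w ih =>
      rw [mon_cons, map_mul, List.map_cons, List.sum_cons]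
      refine mul_mem_finestComp ?_ ih
      rw [evalAt_ι]
      split_ifs
      · exact symplectic_mem (ha _ _)
      · exact ha _ _
  | zero => rw [map_zero]; exact Submodule.zero_mem _
  | add f g _ _ hf hg => rw [map_add]; exact Submodule.add_mem _ hf hg
  | smul c f _ hf => rw [map_smul]; exact Submodule.smul_mem _ _ hf

theorem mul_mem_sympIdentities_left {f g : FreeAlgebra F (Letter (Fin r → ℤ))}
    (hg : g ∈ sympIdentities F r) : f * g ∈ sympIdentities F r :=
  fun a ha => by rw [map_mul, hg a ha, mul_zero]

theorem mul_mem_sympIdentities_right {f g : FreeAlgebra F (Letter (Fin r → ℤ))}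
    (hf : f ∈ sympIdentities F r) : f * g ∈ sympIdentities F r :=
  fun a ha => by rw [map_mul, hf a ha, zero_mul]

/-- The identities of the upper triangular matrices as a two-sided ideal. -/
noncomputable def sympIdeal (F : Type*) [Field F] (r : ℕ) :
    TwoSidedIdeal (FreeAlgebra F (Letter (Fin r → ℤ))) :=
  TwoSidedIdeal.mk' (sympIdentities F r : Set (FreeAlgebra F (Letter (Fin r → ℤ))))
    (Submodule.zero_mem _) (fun h1 h2 => Submodule.add_mem _ h1 h2)
    (fun h => Submodule.neg_mem _ h)
    (fun h => mul_mem_sympIdentities_left h) (fun h => mul_mem_sympIdentities_right h)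

theorem mem_sympIdeal {f : FreeAlgebra F (Letter (Fin r → ℤ))} :
    f ∈ sympIdeal F r ↔ f ∈ sympIdentities F r :=
  TwoSidedIdeal.mem_mk' _ _ _ _ _ _ _

theorem isTIdeal_sympIdeal : IsTIdeal F (sympIdeal F r) := by
  simp only [IsTIdeal, mem_sympIdeal]
  constructor
  · intro f hf a ha
    rw [evalAt_freeInv, hf a ha, symplectic_zero]
  · intro φ hφ f hf a ha
    -- Evaluating after φ is again an evaluation, at the values of the polynomials φ(x_{i,g}), which
    -- are homogeneous of degree g.
    have key : (evalAt (symplectic F) a).comp φ = evalAt (symplectic F)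
        (fun i g => evalAt (symplectic F) a (φ (x F i g))) := by
      refine FreeAlgebra.hom_ext (funext fun l => ?_)
      obtain ⟨i, g, s⟩ := l
      rw [Function.comp_apply, Function.comp_apply, AlgHom.comp_apply, evalAt_ι]
      cases s
      · rfl
      · have h : freeInv F (x F i g) = FreeAlgebra.ι F ⟨i, g, true⟩ := freeInv_ι _
        rw [if_pos rfl, ← evalAt_freeInv, ← hφ.2, h]
    have := hf (fun i g => evalAt (symplectic F) a (φ (x F i g)))
      (fun i g => evalAt_mem ha (hφ.1 g (x F i g) (ι_mem_freeComp ⟨i, g, false⟩)))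
    rw [← key] at this
    exact this

/-- The three families of identities that generate, together with monomials, all identities. -/
def basicIdentities (F : Type*) [Field F] (r : ℕ) : Set (FreeAlgebra F (Letter (Fin r → ℤ))) :=
  {x F 1 (0 : Fin r → ℤ) * x F 2 0 - x F 2 0 * x F 1 0} ∪
    {f | ∃ g : Fin r → ℤ, Module.finrank F (finestComp F r g) = 1 ∧ f = xs F 1 g + x F 1 g} ∪
    {f | ∃ g : Fin r → ℤ, finestComp F r g = ⊥ ∧ f = x F 1 g}

theorem basicIdentities_subset {f : FreeAlgebra F (Letter (Fin r → ℤ))}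
    (hf : f ∈ basicIdentities F r) : f ∈ sympIdentities F r := by
  rcases hf with (hf | ⟨g, hg, rfl⟩) | ⟨g, hg, rfl⟩ <;> intro a ha
  · rw [Set.mem_singleton_iff.mp hf, map_sub, map_mul, map_mul, sub_eq_zero]
    refine mul_comm_of_mem_zero ?_ ?_ <;> rw [x, evalAt_ι] <;> exact ha _ _
  · rw [map_add, xs, x, evalAt_ι, evalAt_ι]
    exact symplectic_eq_neg hg (ha _ _)
  · rw [x, evalAt_ι]
    have h := ha 1 g
    change _ ∈ finestComp F r g at h
    rw [hg] at h
    exact (Submodule.mem_bot F).mp h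

end Identities

/-! ### Consequences of the basic identities for homogeneous polynomials. -/

section TIdeals

variable {F : Type*} [Field F] {r : ℕ} {J : TwoSidedIdeal (FreeAlgebra F (Letter (Fin r → ℤ)))}

theorem smul_mem_twoSided {R A : Type*} [CommRing R] [Ring A] [Algebra R A] (J : TwoSidedIdeal A)
    (c : R) {f : A} (hf : f ∈ J) : c • f ∈ J := by
  rw [Algebra.smul_def]; exact J.mul_mem_left _ _ hf

/-- Here and in the next two lemmas homogeneous polynomials are substituted into a basic identity;
indeterminates of the other degrees go to 0. -/
theorem commutator_mem (hJ : IsTIdeal F J) (hb : ∀ f ∈ basicIdentities F r, f ∈ J)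
    {p q : FreeAlgebra F (Letter (Fin r → ℤ))} (hp : p ∈ freeComp F 0) (hq : q ∈ freeComp F 0) :
    p * q - q * p ∈ J := by
  classical
  have h := hJ.2 _ (isGradedInvEnd_subst (p := fun i g => if g = 0 then if i = 1 then p else q
    else 0) ?_) _ (hb _ (Or.inl (Or.inl rfl)))
  · simpa [x, subst_ι] using h
  · intro i g
    split_ifs with h1 h2
    · exact h1 ▸ hp
    · exact h1 ▸ hq
    · exact Submodule.zero_mem _

theorem freeInv_add_mem (hJ : IsTIdeal F J) (hb : ∀ f ∈ basicIdentities F r, f ∈ J)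
    {g : Fin r → ℤ} (hg : Module.finrank F (finestComp F r g) = 1)
    {p : FreeAlgebra F (Letter (Fin r → ℤ))} (hp : p ∈ freeComp F g) :
    freeInv F p + p ∈ J := by
  classical
  have h := hJ.2 _ (isGradedInvEnd_subst (p := fun i h => if h = g then p else 0) ?_) _
    (hb _ (Or.inl (Or.inr ⟨g, hg, rfl⟩)))
  · simpa [x, xs, subst_ι] using h
  · intro i g
    split_ifs with h1
    · exact h1 ▸ hp
    · exact Submodule.zero_mem _

theorem mem_of_comp_eq_bot (hJ : IsTIdeal F J) (hb : ∀ f ∈ basicIdentities F r, f ∈ J)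
    {g : Fin r → ℤ} (hg : finestComp F r g = ⊥)
    {p : FreeAlgebra F (Letter (Fin r → ℤ))} (hp : p ∈ freeComp F g) : p ∈ J := by
  classical
  have h := hJ.2 _ (isGradedInvEnd_subst (p := fun i h => if h = g then p else 0) ?_) _
    (hb _ (Or.inr ⟨g, hg, rfl⟩))
  · simpa [x, subst_ι] using h
  · intro i g
    split_ifs with h1
    · exact h1 ▸ hp
    · exact Submodule.zero_mem _

end TIdeals

/-! ### Walks spelled by words. -/

section Walk

variable {V L : Type*} (R : V → L → V → Prop)

/-- A walk along the word `w`, where `R p l q` says that the letter `l` leads from `p` to `q`. -/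
def Walk : V → List L → V → Prop
  | p, [], q => p = q
  | p, l :: w, q => ∃ s, R p l s ∧ Walk s w q

variable {R}

@[simp] theorem walk_nil {p q : V} : Walk R p [] q ↔ p = q := Iff.rfl

theorem walk_cons {p q : V} {l : L} {w : List L} :
    Walk R p (l :: w) q ↔ ∃ s, R p l s ∧ Walk R s w q := Iff.rfl

theorem walk_append {p q : V} {u w : List L} :
    Walk R p (u ++ w) q ↔ ∃ s, Walk R p u s ∧ Walk R s w q := by
  induction u generalizing p with
  | nil => simp
  | cons l u ih =>
    simp only [List.cons_append, walk_cons, ih]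
    constructor
    · rintro ⟨s, h1, s', h2, h3⟩; exact ⟨s', ⟨s, h1, h2⟩, h3⟩
    · rintro ⟨s', ⟨s, h1, h2⟩, h3⟩; exact ⟨s, h1, s', h2, h3⟩

theorem Walk.mono {R' : V → L → V → Prop} {w : List L} (h : ∀ l ∈ w, ∀ p q, R p l q → R' p l q)
    {p q : V} (hw : Walk R p w q) : Walk R' p w q := by
  induction w generalizing p with
  | nil => exact hw
  | cons l w ih =>
    obtain ⟨s, h1, h2⟩ := hw
    exact ⟨s, h l List.mem_cons_self _ _ h1, ih (fun l hl => h l (List.mem_cons_of_mem _ hl)) h2⟩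

end Walk

/-! ### Walks on the vertices and their edges. -/

section Steps

variable {r : ℕ}

/-- The letter `l` can act as the matrix unit `e_{pq}`. -/
def DStep (p : Fin (2 * r)) (l : Letter (Fin r → ℤ)) (q : Fin (2 * r)) : Prop :=
  p ≤ q ∧ l.deg = finestTuple r p - finestTuple r q

/-- The letter `l` acts as the matrix unit `e_{pq}` up to sign when the matrix unit with indices
`e i` is substituted for the indeterminate of index `i`. -/
def EStep (e : ℕ → Fin (2 * r) × Fin (2 * r)) (p : Fin (2 * r)) (l : Letter (Fin r → ℤ))
    (q : Fin (2 * r)) : Prop :=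
  DStep p l q ∧ e l.idx = if l.starred then (q.rev, p.rev) else (p, q)

variable {e : ℕ → Fin (2 * r) × Fin (2 * r)} {p q : Fin (2 * r)}
  {w : List (Letter (Fin r → ℤ))}

theorem Walk.toDStep (h : Walk (EStep e) p w q) : Walk DStep p w q :=
  h.mono fun _ _ _ _ h => h.1

theorem Walk.le (h : Walk DStep p w q) : p ≤ q := by
  induction w generalizing p with
  | nil => exact h.le
  | cons l w ih => obtain ⟨s, h1, h2⟩ := h; exact h1.1.trans (ih h2)

theorem Walk.wdeg_eq (h : Walk DStep p w q) :
    wdeg w = finestTuple r p - finestTuple r q := by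
  induction w generalizing p with
  | nil => rw [walk_nil] at h; simp [h]
  | cons l w ih =>
    obtain ⟨s, h1, h2⟩ := h
    rw [wdeg_cons, h1.2, ih h2, sub_add_sub_cancel]

theorem DStep.deg_eq_zero_iff {l : Letter (Fin r → ℤ)} (h : DStep p l q) : l.deg = 0 ↔ p = q := by
  rw [h.2, sub_eq_zero]
  exact finestTuple_injective.eq_iff

theorem Walk.eq_of_wdeg {q' : Fin (2 * r)} {w' : List (Letter (Fin r → ℤ))}
    (h : Walk DStep p w q) (h' : Walk DStep p w' q') (hw : wdeg w = wdeg w') : q = q' := by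
  rw [h.wdeg_eq, h'.wdeg_eq] at hw
  exact finestTuple_injective (sub_right_injective hw)

/-- As the indices are distinct, each letter may name its own edge. A starred letter names the
reflected edge, which the involution turns back. -/
theorem exists_edges (h : Walk DStep p w q) (hw : (w.map Letter.idx).Nodup) :
    ∃ e, Walk (EStep e) p w q := by
  induction w generalizing p with
  | nil => exact ⟨fun _ => (p, p), h⟩
  | cons l w ih =>
    obtain ⟨s, h1, h2⟩ := h
    rw [List.map_cons, List.nodup_cons] at hw
    obtain ⟨e, he⟩ := ih h2 hw.2
    refine ⟨Function.update e l.idx (if l.starred then (s.rev, p.rev) else (p, s)), s, ⟨h1, ?_⟩, ?_⟩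
    · rw [Function.update_self]
    · refine he.mono fun l' hl' a b hab => ⟨hab.1, ?_⟩
      rw [Function.update_of_ne, hab.2]
      rintro h
      exact hw.1 (h ▸ List.mem_map_of_mem hl')

end Steps

/-! ### Nonzero entries of evaluated monomials correspond to walks. -/

section Evaluation

variable {F : Type*} [Field F] {r : ℕ} {p q : Fin (2 * r)}

/-- A nonzero entry of a product has a nonzero term, which provides the intermediate vertex. The
relation is left general so as to serve both `DStep` and `EStep`. -/
theorem walk_of_entry_ne_zero {a : ℕ → (Fin r → ℤ) → UT F (2 * r)}
    {R : Fin (2 * r) → Letter (Fin r → ℤ) → Fin (2 * r) → Prop}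
    (hR : ∀ p l q, (evalAt (symplectic F) a (FreeAlgebra.ι F l) : Matrix (Fin (2 * r)) (Fin (2 * r)) F) p q ≠ 0 → R p l q)
    {w : List (Letter (Fin r → ℤ))}
    (h : (evalAt (symplectic F) a (mon F w) : Matrix (Fin (2 * r)) (Fin (2 * r)) F) p q ≠ 0) : Walk R p w q := by
  induction w generalizing p with
  | nil =>
    rw [mon_nil, map_one] at h
    by_contra hpq
    exact h (Matrix.one_apply_ne hpq)
  | cons l w ih =>
    rw [mon_cons, map_mul, UT.mul_apply'] at h
    obtain ⟨s, -, hs⟩ := Finset.exists_ne_zero_of_sum_ne_zero h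
    exact ⟨s, hR _ _ _ (left_ne_zero_of_mul hs), ih (right_ne_zero_of_mul hs)⟩

theorem entry_ne_zero_of_mem {g : Fin r → ℤ} {A : UT F (2 * r)} (hA : A ∈ finestComp F r g)
    (h : (A : Matrix (Fin (2 * r)) (Fin (2 * r)) F) p q ≠ 0) : p ≤ q ∧ g = finestTuple r p - finestTuple r q := by
  constructor
  · by_contra hpq
    exact h (A.2 (not_le.mp hpq))
  · by_contra hg
    exact h (hA p q fun h' => hg h'.symm)

theorem exists_walk_of_notMem {w : List (Letter (Fin r → ℤ))}
    (h : mon F w ∉ sympIdentities F r) : ∃ p q, Walk DStep p w q := by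
  have h' : ¬ ∀ a : ℕ → (Fin r → ℤ) → UT F (2 * r), (∀ i g, a i g ∈ finestComp F r g) →
    evalAt (symplectic F) a (mon F w) = 0 := h
  push Not at h'
  obtain ⟨a, ha, hne⟩ := h'
  have : ∃ p q : Fin (2 * r), (evalAt (symplectic F) a (mon F w) : Matrix (Fin (2 * r)) (Fin (2 * r)) F) p q ≠ 0 := by
    by_contra hc
    push Not at hc
    exact hne (UT.ext' hc)
  obtain ⟨p, q, hpq⟩ := this
  exact ⟨p, q, walk_of_entry_ne_zero
    (fun p l q h => entry_ne_zero_of_mem (evalAt_mem ha (ι_mem_freeComp l)) h) hpq⟩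

open Classical in
/-- The substitution of the matrix unit with indices `e i` for the indeterminate of index `i`. -/
noncomputable def edgeSubst (F : Type*) [Field F] {r : ℕ} (e : ℕ → Fin (2 * r) × Fin (2 * r))
    (i : ℕ) (g : Fin r → ℤ) : UT F (2 * r) :=
  if h : (e i).1 ≤ (e i).2 then
    if finestTuple r (e i).1 - finestTuple r (e i).2 = g then unit F (e i).1 (e i).2 h else 0
  else 0

variable {e : ℕ → Fin (2 * r) × Fin (2 * r)}

theorem edgeSubst_mem (i : ℕ) (g : Fin r → ℤ) : edgeSubst F e i g ∈ finestComp F r g := by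
  unfold edgeSubst
  split_ifs with h1 h2
  · exact unit_mem _ _ _ h2
  · exact Submodule.zero_mem _
  · exact Submodule.zero_mem _

theorem edgeSubst_apply_ne_zero {i : ℕ} {g : Fin r → ℤ}
    (h : (edgeSubst F e i g : Matrix (Fin (2 * r)) (Fin (2 * r)) F) p q ≠ 0) : e i = (p, q) := by
  unfold edgeSubst at h
  split_ifs at h with h1 h2
  · rw [unit_apply] at h
    by_contra hne
    rw [if_neg] at h
    · exact h rfl
    · rintro ⟨h3, h4⟩
      exact hne (Prod.ext h3 h4)
  · exact absurd rfl h
  · exact absurd rfl h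

theorem eStep_of_entry_ne_zero {l : Letter (Fin r → ℤ)}
    (h : (evalAt (symplectic F) (edgeSubst F e) (FreeAlgebra.ι F l) : Matrix (Fin (2 * r)) (Fin (2 * r)) F) p q ≠ 0) :
    EStep e p l q := by
  refine ⟨entry_ne_zero_of_mem (evalAt_mem edgeSubst_mem (ι_mem_freeComp l)) h, ?_⟩
  rw [evalAt_ι] at h
  split_ifs at h ⊢ with hs
  · rw [symplectic_apply] at h
    exact edgeSubst_apply_ne_zero (right_ne_zero_of_mul (left_ne_zero_of_mul h))
  · exact edgeSubst_apply_ne_zero h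

theorem walk_of_edgeSubst_ne_zero {w : List (Letter (Fin r → ℤ))}
    (h : (evalAt (symplectic F) (edgeSubst F e) (mon F w) : Matrix (Fin (2 * r)) (Fin (2 * r)) F) p q ≠ 0) :
    Walk (EStep e) p w q := by
  refine walk_of_entry_ne_zero (a := edgeSubst F e) ?_ h
  intro p l q h
  exact eStep_of_entry_ne_zero h

theorem edgeSubst_eq_unit {i : ℕ} {g : Fin r → ℤ} (hpq : p ≤ q)
    (hg : g = finestTuple r p - finestTuple r q) (h : e i = (p, q)) :
    edgeSubst F e i g = unit F p q hpq := by
  unfold edgeSubst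
  simp only [h, hg, hpq, dite_true, if_true]

theorem UT.smul_apply' {m : ℕ} (c : F) (A : UT F m) (i j : Fin m) :
    ((c • A : UT F m) : Matrix (Fin m) (Fin m) F) i j =
      c * (A : Matrix (Fin m) (Fin m) F) i j := rfl

theorem symplectic_unit {i j : Fin (2 * r)} (h : i ≤ j) :
    symplectic F (unit F j.rev i.rev (Fin.rev_le_rev.mpr h)) =
      (sgn F i * sgn F j) • unit F i j h := by
  refine UT.ext' fun a b => ?_
  rw [symplectic_apply, UT.smul_apply', unit_apply, unit_apply]
  by_cases hab : i = a ∧ j = b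
  · obtain ⟨rfl, rfl⟩ := hab
    simp
  · rw [if_neg hab, if_neg]
    · simp
    · rintro ⟨h4, h5⟩
      exact hab ⟨Fin.rev_injective h5, Fin.rev_injective h4⟩

theorem EStep.eval {l : Letter (Fin r → ℤ)} (h : EStep e p l q) :
    ∃ c : F, c ≠ 0 ∧ evalAt (symplectic F) (edgeSubst F e) (FreeAlgebra.ι F l) =
      c • unit F p q h.1.1 := by
  rw [evalAt_ι]
  obtain ⟨⟨h1, h2⟩, h3⟩ := h
  split_ifs at h3 ⊢ with hs
  · refine ⟨sgn F p * sgn F q, mul_ne_zero (sgn_ne_zero _) (sgn_ne_zero _), ?_⟩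
    rw [edgeSubst_eq_unit (Fin.rev_le_rev.mpr h1) (by rw [h2, finestTuple_sub_rev]) h3,
      symplectic_unit h1]
  · refine ⟨1, one_ne_zero, ?_⟩
    rw [edgeSubst_eq_unit h1 h2 h3, one_smul]

theorem unit_mul_unit {m : ℕ} {i j k : Fin m} (h1 : i ≤ j) (h2 : j ≤ k) :
    unit F i j h1 * unit F j k h2 = unit F i k (h1.trans h2) := by
  refine Subtype.ext ?_
  change Matrix.single i j (1 : F) * Matrix.single j k 1 = Matrix.single i k 1
  rw [Matrix.single_mul_single_same, one_mul]

theorem Walk.eval {w : List (Letter (Fin r → ℤ))} (h : Walk (EStep e) p w q) :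
    ∃ c : F, c ≠ 0 ∧ (evalAt (symplectic F) (edgeSubst F e) (mon F w) : Matrix (Fin (2 * r)) (Fin (2 * r)) F) p q = c := by
  -- The factor e_{qq} isolates column q and makes the induction start: the empty word evaluates to
  -- 1, not to a matrix unit.
  suffices H : ∃ c : F, c ≠ 0 ∧ evalAt (symplectic F) (edgeSubst F e) (mon F w) *
      unit F q q le_rfl = c • unit F p q h.toDStep.le by
    obtain ⟨c, hc, H⟩ := H
    refine ⟨c, hc, ?_⟩
    have h1 := congrArg (fun A : UT F (2 * r) => (A : Matrix (Fin (2 * r)) (Fin (2 * r)) F) p q) H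
    simp only [UT.mul_apply', UT.smul_apply', unit_apply] at h1
    rw [Finset.sum_eq_single q (by intro b _ hb; simp [Ne.symm hb]) (by simp)] at h1
    simpa only [and_self, if_true, mul_one] using h1
  induction w generalizing p with
  | nil =>
    rw [walk_nil] at h
    subst h
    exact ⟨1, one_ne_zero, by rw [mon_nil, map_one, one_mul, one_smul]⟩
  | cons l w ih =>
    obtain ⟨s, h1, h2⟩ := h
    obtain ⟨c, hc, h3⟩ := ih h2
    obtain ⟨d, hd, h4⟩ := h1.eval (F := F)
    refine ⟨c * d, mul_ne_zero hc hd, ?_⟩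
    rw [mon_cons, map_mul, mul_assoc, h3, h4, smul_mul_smul_comm, unit_mul_unit, mul_comm d c]

theorem notMem_of_walk {w : List (Letter (Fin r → ℤ))} (h : Walk DStep p w q)
    (hw : (w.map Letter.idx).Nodup) : mon F w ∉ sympIdentities F r := by
  obtain ⟨e, he⟩ := exists_edges h hw
  obtain ⟨c, hc, h1⟩ := he.eval (F := F)
  intro hmem
  rw [hmem _ edgeSubst_mem] at h1
  exact hc h1.symm

end Evaluation

/-! ### A good word is determined by the edges of its indices and its end points. -/

section Uniqueness

variable {F : Type*} [Field F] {r : ℕ}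

/-- The conditions on good monomials, expressed through contiguous subwords. -/
structure LocallyGood (F : Type*) [Field F] {r : ℕ} (w : List (Letter (Fin r → ℤ))) : Prop where
  sorted : ∀ u v s, w = u ++ v ++ s → (∀ l ∈ v, l.deg = 0) →
    v.Pairwise fun l l' => l.idx < l'.idx
  no_neutral : ∀ u d z s, w = u ++ d :: z ++ s → d.deg = 0 →
    Module.finrank F (finestComp F r (wdeg (d :: z))) ≠ 1
  ends : ∀ u a z b s, w = u ++ (a :: z ++ [b]) ++ s → b.deg ≠ 0 →
    Module.finrank F (finestComp F r (wdeg (a :: z ++ [b]))) = 1 → a.idx < b.idx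
  unstarred : ∀ a ∈ w, Module.finrank F (finestComp F r a.deg) = 1 → a.starred = false

theorem LocallyGood.tail {l : Letter (Fin r → ℤ)} {w : List (Letter (Fin r → ℤ))}
    (h : LocallyGood F (l :: w)) : LocallyGood F w where
  sorted u v s hw := h.sorted (l :: u) v s (by simp [hw])
  no_neutral u d z s hw := h.no_neutral (l :: u) d z s (by simp [hw])
  ends u a z b s hw := h.ends (l :: u) a z b s (by simp [hw])
  unstarred a ha := h.unstarred a (List.mem_cons_of_mem _ ha)

theorem rev_ne (p : Fin (2 * r)) : p ≠ p.rev := by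
  intro h
  have h1 := congrArg Fin.val h
  rw [Fin.val_rev] at h1
  omega

theorem Walk.finrank_eq_one {p : Fin (2 * r)} {w : List (Letter (Fin r → ℤ))}
    (h : Walk DStep p w p.rev) : Module.finrank F (finestComp F r (wdeg w)) = 1 := by
  rw [h.wdeg_eq]
  exact finrank_sub_rev (lt_of_le_of_ne h.le (rev_ne p))

theorem Walk.neutral {p : Fin (2 * r)} {w : List (Letter (Fin r → ℤ))}
    (h : Walk DStep p w p) : ∀ l ∈ w, l.deg = 0 := by
  induction w with
  | nil => simp
  | cons l w ih =>
    obtain ⟨s, h1, h2⟩ := h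
    have h3 : p = s := le_antisymm h1.1 h2.le
    subst h3
    intro l' hl'
    rcases List.mem_cons.mp hl' with rfl | hl'
    · exact h1.deg_eq_zero_iff.mpr rfl
    · exact ih h2 l' hl'

theorem exists_last_step {p q : Fin (2 * r)} {R : Fin (2 * r) → Letter (Fin r → ℤ) →
    Fin (2 * r) → Prop} {w : List (Letter (Fin r → ℤ))} (h : Walk R p w q) (hpq : p ≠ q) :
    ∃ u l s x, w = u ++ l :: s ∧ Walk R p u x ∧ R x l q ∧ x ≠ q := by
  induction w generalizing p with
  | nil => exact absurd h hpq
  | cons l w ih =>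
    obtain ⟨y, h1, h2⟩ := h
    by_cases hy : y = q
    · subst hy
      exact ⟨[], l, w, p, rfl, rfl, h1, hpq⟩
    · obtain ⟨u, l', s, x, rfl, h3, h4, h5⟩ := ih h2 hy
      exact ⟨l :: u, l', s, x, rfl, ⟨y, h1, h3⟩, h4, h5⟩

/-- A closed walk consists of neutral letters, so a letter that leaves p is the first non-neutral
letter of the word. -/
theorem exit_unique {p a b : Fin (2 * r)} {u u' s s' : List (Letter (Fin r → ℤ))}
    {l l' : Letter (Fin r → ℤ)} (h : u ++ l :: s = u' ++ l' :: s') (h1 : Walk DStep p u p)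
    (h2 : Walk DStep p u' p) (h3 : DStep p l a) (h4 : DStep p l' b) (h5 : p ≠ a) (h6 : p ≠ b) :
    l = l' := by
  induction u generalizing u' with
  | nil =>
    cases u' with
    | nil => exact (List.cons.inj h).1
    | cons m u' =>
      obtain ⟨rfl, -⟩ := List.cons.inj h
      exact absurd (h3.deg_eq_zero_iff.mp (h2.neutral _ List.mem_cons_self)) h5
  | cons m u ih =>
    have hm := h1.neutral m List.mem_cons_self
    cases u' with
    | nil =>
      obtain ⟨rfl, -⟩ := List.cons.inj h
      exact absurd (h4.deg_eq_zero_iff.mp hm) h6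
    | cons m' u' =>
      obtain ⟨rfl, h'⟩ := List.cons.inj h
      refine ih h' ?_ ?_
      · obtain ⟨x, hx, hx'⟩ := h1
        obtain rfl := hx.deg_eq_zero_iff.mp hm
        exact hx'
      · obtain ⟨x, hx, hx'⟩ := h2
        obtain rfl := hx.deg_eq_zero_iff.mp hm
        exact hx'

variable {e : ℕ → Fin (2 * r) × Fin (2 * r)} {p q c c' : Fin (2 * r)}
  {l l' : Letter (Fin r → ℤ)} {w w' : List (Letter (Fin r → ℤ))}

theorem EStep.deg_eq (h : EStep e p l q) :
    l.deg = finestTuple r (e l.idx).1 - finestTuple r (e l.idx).2 := by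
  rw [h.2, h.1.2]
  split_ifs
  · rw [finestTuple_sub_rev]
  · rfl

theorem EStep.same {x y : Fin (2 * r)} (h : EStep e p l q) (h' : EStep e x l' y)
    (hidx : l'.idx = l.idx) :
    (l' = l ∧ x = p ∧ y = q) ∨ (l'.starred ≠ l.starred ∧ x = q.rev ∧ y = p.rev) := by
  have hdeg : l'.deg = l.deg := by rw [h.deg_eq, h'.deg_eq, hidx]
  have h2 := h.2
  have h3 := h'.2
  rw [hidx, h2] at h3
  obtain ⟨i, g, s⟩ := l
  obtain ⟨i', g', s'⟩ := l'
  simp only at hidx hdeg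
  subst hidx hdeg
  cases s <;> cases s' <;> simp at h3 ⊢ <;> obtain ⟨h4, h5⟩ := h3
  · exact ⟨h4.symm, h5.symm⟩
  · rw [h4, h5, Fin.rev_rev, Fin.rev_rev]; exact ⟨rfl, rfl⟩
  · exact ⟨h4.symm, h5.symm⟩
  · exact ⟨h5.symm, h4.symm⟩

/-- The index fixes the matrix unit and the star decides between it and its reflection. So a letter
known from another word is met in w on the same edge or on the reflected one. -/
theorem exists_occurrence (h : Walk (EStep e) p w q) {a b : Fin (2 * r)} (hl : EStep e a l b)
    (hmem : l.idx ∈ w.map Letter.idx) :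
    ∃ u m s x y, w = u ++ m :: s ∧ Walk DStep p u x ∧ DStep x m y ∧ m.idx = l.idx ∧
      m.deg = l.deg ∧ ((m = l ∧ x = a ∧ y = b) ∨ (x = b.rev ∧ y = a.rev)) := by
  obtain ⟨m, hm, hidx⟩ := List.mem_map.mp hmem
  obtain ⟨u, s, rfl⟩ := List.append_of_mem hm
  obtain ⟨x, h1, y, h2, h3⟩ := walk_append.mp h
  refine ⟨u, m, s, x, y, rfl, h1.toDStep, h2.1, hidx, by rw [hl.deg_eq, h2.deg_eq, hidx], ?_⟩
  rcases hl.same h2 hidx with h4 | h4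
  · exact Or.inl h4
  · exact Or.inr h4.2

/-- A walk from p to p.rev has a degree with one-dimensional component, and no subword of such a
degree may begin with a neutral letter. -/
theorem LocallyGood.not_walk_rev (hw : LocallyGood F (l :: w)) (hl : l.deg = 0)
    {v s : List (Letter (Fin r → ℤ))} (hv : l :: w = v ++ s) : ¬ Walk DStep p v p.rev := by
  intro h
  cases v with
  | nil => exact rev_ne p h
  | cons d z =>
    obtain ⟨rfl, -⟩ := List.cons.inj hv
    exact hw.no_neutral [] l z s hv hl h.finrank_eq_one

/-- Here l' is the first letter of a competing word and m its occurrence in l :: w. If m uses the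
same edge, everything before it is a closed walk at p, so all letters up to m are neutral and
sorted. If m uses the reflected edge, the walk reaches p.rev: this is impossible for neutral
letters, and otherwise the condition `ends` applies. By symmetry two competing words would each need
the smaller first index. -/
theorem LocallyGood.idx_lt (hw : LocallyGood F (l :: w)) (h : Walk (EStep e) p (l :: w) q)
    (hl : EStep e p l' c') (hmem : l'.idx ∈ (l :: w).map Letter.idx) (hne : l.idx ≠ l'.idx)
    (hdeg : l.deg = 0 ↔ l'.deg = 0) : l.idx < l'.idx := by
  obtain ⟨u, m, s, x, y, hu, h1, h2, hidx, hmdeg, h3⟩ := exists_occurrence h hl hmem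
  cases u with
  | nil =>
    obtain ⟨rfl, -⟩ := List.cons.inj hu
    exact absurd hidx hne
  | cons d u =>
    obtain ⟨rfl, -⟩ := List.cons.inj hu
    rcases h3 with ⟨rfl, rfl, rfl⟩ | ⟨rfl, rfl⟩
    · have hneut := h1.neutral
      have h4 := hw.sorted [] ((l :: u) ++ [m]) s (by simp [hu]) (by
        intro k hk
        rcases List.mem_append.mp hk with hk | hk
        · exact hneut k hk
        · rw [List.mem_singleton.mp hk]
          exact hdeg.mp (hneut l List.mem_cons_self))
      exact (List.pairwise_append.mp h4).2.2 l List.mem_cons_self m (by simp)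
    · by_cases h0 : l'.deg = 0
      · rw [← hl.1.deg_eq_zero_iff.mp h0] at h1
        exact absurd h1 (hw.not_walk_rev (hdeg.mpr h0) hu)
      · rw [← hidx]
        refine hw.ends [] l u m s (by simp [hu]) (hmdeg ▸ h0) ?_
        have h4 : Walk DStep p (l :: u ++ [m]) p.rev :=
          walk_append.mpr ⟨_, h1, _, h2, rfl⟩
        exact h4.finrank_eq_one

theorem LocallyGood.not_neutral_nonneutral (hw : LocallyGood F (l :: w))
    (h : Walk (EStep e) p (l :: w) q) (h' : Walk (EStep e) p (l' :: w') q)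
    (hnd : ((l' :: w').map Letter.idx).Nodup)
    (hperm : ((l :: w).map Letter.idx).Perm ((l' :: w').map Letter.idx))
    (hl : l.deg = 0) (hl' : l'.deg ≠ 0) : False := by
  obtain ⟨c, hc, -⟩ := id h
  obtain ⟨c', hc', -⟩ := id h'
  have hpc : p = c := hc.1.deg_eq_zero_iff.mp hl
  subst hpc
  have hpc' : p ≠ c' := fun h => hl' (hc'.1.deg_eq_zero_iff.mpr h)
  obtain ⟨u', m', s', x', y', hu', h1', h2', hidx', hmdeg', h3'⟩ := exists_occurrence h' hc
    (hperm.mem_iff.mp (by simp))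
  have hu0 : ∃ u0, u' = l' :: u0 := by
    cases u' with
    | nil =>
      obtain ⟨rfl, -⟩ := List.cons.inj hu'
      exact absurd (hmdeg'.trans hl) hl'
    | cons d u0 => exact ⟨u0, by rw [(List.cons.inj hu').1]⟩
  obtain ⟨u0, rfl⟩ := hu0
  -- In the second word the index of the neutral letter l is a loop at p or at p.rev. The loop at p
  -- is excluded because the word has already left p.
  have h4 : Walk DStep p (l' :: u0) p.rev := by
    rcases h3' with ⟨rfl, rfl, rfl⟩ | ⟨rfl, rfl⟩
    · exact absurd (h1'.neutral l' List.mem_cons_self) hl'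
    · exact h1'
  have hwalk' : Walk (EStep e) p (l' :: u0 ++ m' :: s') q := hu' ▸ h'
  obtain ⟨z, hz, -⟩ := walk_append.mp hwalk'
  have hzz : z = p.rev := hz.toDStep.eq_of_wdeg h4 rfl
  subst hzz
  obtain ⟨u, m, s, x, y, hu, h1, h2, hidx, hmdeg, h3⟩ := exists_occurrence h hc'
    (hperm.mem_iff.mpr (by simp))
  -- The reflected edge of l' ends at p.rev, which the first word cannot reach. So the first word
  -- also leaves p through l'.
  rcases h3 with ⟨rfl, rfl, rfl⟩ | ⟨rfl, rfl⟩
  swap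
  · refine hw.not_walk_rev (p := p) (v := u ++ [m]) (s := s) hl (by simp [hu]) ?_
    exact walk_append.mpr ⟨_, h1, _, h2, rfl⟩
  -- Let k be the letter by which the second word enters p.rev. If it is its first letter, the first
  -- word reaches p.rev too.
  obtain ⟨u1, k, s1, z, hk, hk1, hk2, hk3⟩ := exists_last_step hz (rev_ne x)
  cases u1 with
  | nil =>
    obtain ⟨rfl, -⟩ := List.cons.inj hk
    have : x = z := hk1
    subst this
    refine hw.not_walk_rev (p := x) (v := u ++ [m]) (s := s) hl (by simp [hu]) ?_
    exact walk_append.mpr ⟨_, h1, _, hk2.1, rfl⟩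
  | cons d u1 =>
    obtain ⟨rfl, hk'⟩ := List.cons.inj hk
    have hkne : m.idx ≠ k.idx := by
      rw [List.map_cons, List.nodup_cons] at hnd
      intro hcon
      refine hnd.1 (hcon ▸ List.mem_map_of_mem ?_)
      have : w' = u0 ++ m' :: s' := (List.cons.inj hu').2
      rw [this, hk']
      simp
    -- In the first word the index of k either enters p.rev, which is excluded, or leaves p. But the
    -- only letter leaving p is l', whose index differs from that of k.
    obtain ⟨v, n, t, a, b, hv, g1, g2, gidx, gdeg, g3⟩ := exists_occurrence h hk2
      (hperm.mem_iff.mpr (by rw [hu', hk]; simp))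
    rcases g3 with ⟨rfl, rfl, rfl⟩ | ⟨rfl, rfl⟩
    · refine hw.not_walk_rev (p := x) (v := v ++ [n]) (s := t) hl (by simp [hv]) ?_
      exact walk_append.mpr ⟨_, g1, _, g2, rfl⟩
    · rw [Fin.rev_rev] at g1 g2
      have := exit_unique (hu.symm.trans hv) h1 g1 h2 g2 hpc'
        (fun hcon => hk3 (by rw [hcon, Fin.rev_rev]))
      exact hkne (this ▸ gidx)

theorem LocallyGood.unique (hw : LocallyGood F w) (hw' : LocallyGood F w')
    (h : Walk (EStep e) p w q) (h' : Walk (EStep e) p w' q)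
    (hnd : (w.map Letter.idx).Nodup)
    (hperm : (w.map Letter.idx).Perm (w'.map Letter.idx)) : w = w' := by
  induction w generalizing p w' with
  | nil =>
    rw [List.map_nil, List.nil_perm, List.map_eq_nil_iff] at hperm
    exact hperm.symm
  | cons l w ih =>
    cases w' with
    | nil => simpa using hperm.length_eq
    | cons l' w' =>
      have hnd' := hperm.nodup_iff.mp hnd
      have heq : l = l' := by
        obtain ⟨c, hc, -⟩ := id h
        obtain ⟨c', hc', -⟩ := id h'
        by_cases hidx : l'.idx = l.idx
        -- Opposite stars mean that the edges are reflections of each other. As both start at p,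
        -- both end at p.rev, and then neither letter may be starred.
        · rcases hc.same hc' hidx with ⟨h1, -⟩ | ⟨h1, h2, h3⟩
          · exact h1.symm
          · exfalso
            have hd : ∀ {m b}, DStep p m b → b = p.rev →
                Module.finrank F (finestComp F r m.deg) = 1 := by
              rintro m b hm rfl
              rw [hm.2]
              exact finrank_sub_rev (lt_of_le_of_ne hm.1 (rev_ne p))
            have e1 := hw.unstarred l List.mem_cons_self
              (hd hc.1 (by rw [h2, Fin.rev_rev]))
            have e2 := hw'.unstarred l' List.mem_cons_self (hd hc'.1 h3)
            exact h1 (e2.trans e1.symm)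
        · exfalso
          by_cases hdeg : l.deg = 0 ↔ l'.deg = 0
          · have h1 := hw.idx_lt h hc' (hperm.mem_iff.mpr (by simp)) (Ne.symm hidx) hdeg
            have h2 := hw'.idx_lt h' hc (hperm.mem_iff.mp (by simp)) hidx hdeg.symm
            omega
          · by_cases h0 : l.deg = 0
            · exact hw.not_neutral_nonneutral h h' hnd' hperm h0
                fun h1 => hdeg (iff_of_true h0 h1)
            · refine hw'.not_neutral_nonneutral h' h hnd hperm.symm ?_ h0
              by_contra h1
              exact hdeg (iff_of_false h0 h1)
      subst heq
      congr 1
      obtain ⟨c, hc, h1⟩ := h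
      obtain ⟨c', hc', h2⟩ := h'
      have hcc : c = c' := by
        have := hc.1.2.symm.trans hc'.1.2
        exact finestTuple_injective (sub_right_injective this)
      subst hcc
      rw [List.map_cons, List.map_cons, List.perm_cons] at hperm
      rw [List.map_cons, List.nodup_cons] at hnd
      exact ih hw.tail hw'.tail h1 h2 hnd.2 hperm

end Uniqueness

/-! ### Decomposition of words into neutral words and non-neutral letters. -/

section Blocks

variable {G : Type}

/-- The word `M_1 y_1 ⋯ M_k y_k M` given by the list of the pairs `(M_i, y_i)`. -/
def blocks (L : List (List (Letter G) × Letter G)) (M : List (Letter G)) : List (Letter G) :=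
  (L.flatMap fun b => b.1 ++ [b.2]) ++ M

variable {L P Q : List (List (Letter G) × Letter G)} {M : List (Letter G)}
  {b : List (Letter G) × Letter G}

theorem blocks_nil : blocks [] M = M := rfl

theorem blocks_cons : blocks (b :: L) M = b.1 ++ b.2 :: blocks L M := by
  simp [blocks]

theorem blocks_append : blocks (P ++ Q) M = blocks P [] ++ blocks Q M := by
  simp [blocks]

variable [AddCommGroup G]

/-- The total degree of the letters `y_i`. -/
def bdeg (L : List (List (Letter G) × Letter G)) : G := (L.map fun b => b.2.deg).sum

/-- The words `M_i` are neutral and the letters `y_i` are not. -/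
def Separated (L : List (List (Letter G) × Letter G)) : Prop :=
  ∀ b ∈ L, (∀ l ∈ b.1, l.deg = 0) ∧ b.2.deg ≠ 0

@[simp] theorem bdeg_nil : bdeg ([] : List (List (Letter G) × Letter G)) = 0 := rfl
@[simp] theorem bdeg_cons : bdeg (b :: L) = b.2.deg + bdeg L := by simp [bdeg]

theorem wdeg_blocks (h : Separated L) (hM : ∀ l ∈ M, l.deg = 0) : wdeg (blocks L M) = bdeg L := by
  induction L with
  | nil => exact wdeg_eq_zero hM
  | cons b L ih =>
    have hb := h b List.mem_cons_self
    rw [blocks_cons, wdeg_append, wdeg_cons, wdeg_eq_zero hb.1,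
      ih (fun b hb => h b (List.mem_cons_of_mem _ hb)), bdeg_cons, zero_add]

theorem exists_blocks (w : List (Letter G)) :
    ∃ L M, w = blocks L M ∧ Separated L ∧ ∀ l ∈ M, l.deg = 0 := by
  induction w with
  | nil => exact ⟨[], [], rfl, by simp [Separated], by simp⟩
  | cons l w ih =>
    obtain ⟨L, M, rfl, hL, hM⟩ := ih
    by_cases hl : l.deg = 0
    · cases L with
      | nil =>
        refine ⟨[], l :: M, rfl, hL, ?_⟩
        intro k hk
        rcases List.mem_cons.mp hk with rfl | hk
        exacts [hl, hM k hk]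
      | cons b L =>
        refine ⟨(l :: b.1, b.2) :: L, M, by simp [blocks_cons], ?_, hM⟩
        intro c hc
        rcases List.mem_cons.mp hc with rfl | hc
        · refine ⟨?_, (hL b List.mem_cons_self).2⟩
          intro k hk
          rcases List.mem_cons.mp hk with rfl | hk
          exacts [hl, (hL b List.mem_cons_self).1 k hk]
        · exact hL c (List.mem_cons_of_mem _ hc)
    · refine ⟨([], l) :: L, M, by simp [blocks_cons], ?_, hM⟩
      intro c hc
      rcases List.mem_cons.mp hc with rfl | hc
      · exact ⟨by simp, hl⟩
      · exact hL c hc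

/-- The second alternative covers a letter d of the final neutral word. -/
theorem blocks_eq_append_neutral {u t : List (Letter G)} {d : Letter G} (hL : Separated L)
    (hM : ∀ l ∈ M, l.deg = 0) (h : blocks L M = u ++ d :: t) (hd : d.deg = 0) :
    (∃ P b Q N, L = P ++ b :: Q ∧ d ∈ b.1 ∧ (∀ l ∈ N, l.deg = 0) ∧ t = N ++ b.2 :: blocks Q M) ∨
      ∀ l ∈ t, l.deg = 0 := by
  induction L generalizing u with
  | nil =>
    right
    rw [blocks_nil] at h
    subst h
    exact fun l hl => hM l (by simp [hl])
  | cons b L ih =>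
    have hb := hL b List.mem_cons_self
    rw [blocks_cons] at h
    rcases List.append_eq_append_iff.mp h with ⟨c, h1, h2⟩ | ⟨c, h1, h2⟩
    · cases c with
      | nil =>
        rw [List.nil_append] at h2
        exact absurd ((List.cons.inj h2).1 ▸ hd) hb.2
      | cons k c =>
        obtain ⟨rfl, h3⟩ := List.cons.inj h2
        rcases ih (fun b hb => hL b (List.mem_cons_of_mem _ hb)) h3 with ⟨P, b', Q, N, rfl, h4⟩ | h4
        · exact Or.inl ⟨b :: P, b', Q, N, rfl, h4⟩
        · exact Or.inr h4
    · cases c with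
      | nil =>
        rw [List.nil_append] at h2
        exact absurd ((List.cons.inj h2).1 ▸ hd) hb.2
      | cons k c =>
        obtain ⟨rfl, h3⟩ := List.cons.inj h2
        exact Or.inl ⟨[], b, L, c, rfl, by simp [h1], fun l hl => hb.1 l (by simp [h1, hl]), h3⟩

theorem blocks_eq_append_nonneutral {u t : List (Letter G)} {d : Letter G} (hL : Separated L)
    (hM : ∀ l ∈ M, l.deg = 0) (h : blocks L M = u ++ d :: t) (hd : d.deg ≠ 0) :
    ∃ P b Q, L = P ++ b :: Q ∧ b.2 = d ∧ t = blocks Q M := by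
  induction L generalizing u with
  | nil =>
    rw [blocks_nil] at h
    subst h
    exact absurd (hM d (by simp)) hd
  | cons b L ih =>
    have hb := hL b List.mem_cons_self
    rw [blocks_cons] at h
    rcases List.append_eq_append_iff.mp h with ⟨c, h1, h2⟩ | ⟨c, h1, h2⟩
    · cases c with
      | nil =>
        rw [List.nil_append] at h2
        exact ⟨[], b, L, rfl, (List.cons.inj h2).1, (List.cons.inj h2).2.symm⟩
      | cons k c =>
        obtain ⟨rfl, h3⟩ := List.cons.inj h2
        obtain ⟨P, b', Q, rfl, h4⟩ := ih (fun b hb => hL b (List.mem_cons_of_mem _ hb)) h3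
        exact ⟨b :: P, b', Q, rfl, h4⟩
    · cases c with
      | nil =>
        rw [List.nil_append] at h2
        exact ⟨[], b, L, rfl, (List.cons.inj h2).1.symm, (List.cons.inj h2).2⟩
      | cons k c =>
        obtain ⟨rfl, h3⟩ := List.cons.inj h2
        exact absurd (hb.1 d (by simp [h1])) hd

/-- P consists of the blocks whose non-neutral letter lies in the prefix z. A block that is cut off
contributes neutral letters only and does not change the degree. -/
theorem exists_prefix_blocks {z s : List (Letter G)} (hL : Separated L) (hM : ∀ l ∈ M, l.deg = 0)
    (h : blocks L M = z ++ s) : ∃ P Q, L = P ++ Q ∧ wdeg z = bdeg P ∧ (z = [] → P = []) ∧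
      ∀ z' d, z = z' ++ [d] → d.deg ≠ 0 → ∃ P' b, P = P' ++ [b] ∧ b.2 = d := by
  have neutral : ∀ (L : List (List (Letter G) × Letter G)) (z : List (Letter G)),
      (∀ l ∈ z, l.deg = 0) → ∃ P Q, L = P ++ Q ∧ wdeg z = bdeg P ∧ (z = [] → P = []) ∧
      ∀ z' d, z = z' ++ [d] → d.deg ≠ 0 → ∃ P' b, P = P' ++ [b] ∧ b.2 = d := by
    intro L z hz
    refine ⟨[], L, rfl, by rw [wdeg_eq_zero hz, bdeg_nil], fun _ => rfl, ?_⟩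
    rintro z' d rfl hd
    exact absurd (hz d (by simp)) hd
  induction L generalizing z with
  | nil =>
    rw [blocks_nil] at h
    subst h
    exact neutral [] z fun l hl => hM l (by simp [hl])
  | cons b L ih =>
    have hb := hL b List.mem_cons_self
    rw [blocks_cons] at h
    rcases List.append_eq_append_iff.mp h with ⟨c, h1, h2⟩ | ⟨c, h1, h2⟩
    · cases c with
      | nil =>
        refine neutral _ _ fun l hl => hb.1 l ?_
        rwa [h1, List.append_nil] at hl
      | cons k c =>
        obtain ⟨rfl, h3⟩ := List.cons.inj h2
        obtain ⟨P, Q, rfl, h4, h4', h5⟩ := ih (fun b hb => hL b (List.mem_cons_of_mem _ hb)) h3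
        refine ⟨b :: P, Q, rfl, ?_, ?_, ?_⟩
        · rw [h1, wdeg_append, wdeg_cons, wdeg_eq_zero hb.1, h4, bdeg_cons, zero_add]
        · intro hz
          simp [hz] at h1
        · intro z' d hz hd
          rcases List.eq_nil_or_concat c with rfl | ⟨c', d', rfl⟩
          · rw [h1] at hz
            obtain ⟨-, h6⟩ := List.append_inj' hz rfl
            rw [h4' rfl]
            exact ⟨[], b, rfl, (List.cons.inj h6).1⟩
          · obtain ⟨P', b', rfl, h7⟩ := h5 c' d (by
              have h8 : (b.1 ++ b.2 :: c') ++ [d'] = z' ++ [d] := by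
                rw [← hz, h1]; simp
              obtain ⟨-, h9⟩ := List.append_inj' h8 rfl
              rw [(List.cons.inj h9).1, List.concat_eq_append]) hd
            exact ⟨b :: P', b', rfl, h7⟩
    · refine neutral _ _ fun l hl => hb.1 l ?_
      rw [h1]
      exact List.mem_append_left _ hl

end Blocks

/-! ### Goodness of blocks versus goodness of contiguous subwords. -/

section LocallyGood

variable {F : Type*} [Field F] {r : ℕ}
  {L : List (List (Letter (Fin r → ℤ)) × Letter (Fin r → ℤ))} {M : List (Letter (Fin r → ℤ))}

/-- The conditions on good monomials, expressed through the list of the pairs `(M_i, y_i)`. -/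
structure GoodBlocks (F : Type*) [Field F] {r : ℕ}
    (L : List (List (Letter (Fin r → ℤ)) × Letter (Fin r → ℤ)))
    (M : List (Letter (Fin r → ℤ))) : Prop where
  separated : Separated L
  neutral : ∀ l ∈ M, l.deg = 0
  sorted : ∀ b ∈ L, b.1.Pairwise fun l l' => l.idx < l'.idx
  sorted_last : M.Pairwise fun l l' => l.idx < l'.idx
  segment : ∀ P b Z S, L = P ++ (b :: Z) ++ S →
    Module.finrank F (finestComp F r (bdeg (b :: Z))) = 1 →
    b.1 = [] ∧ (Z = [] → b.2.starred = false) ∧ ∀ Z' b', Z = Z' ++ [b'] → b.2.idx < b'.2.idx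

/-- The order of adjacent neutral letters. -/
def NeutralLt {G : Type} [AddCommGroup G] (l l' : Letter G) : Prop :=
  l.deg = 0 → l'.deg = 0 → l.idx < l'.idx

theorem pairwise_of_isChain_neutralLt {G : Type} [AddCommGroup G] {u v s : List (Letter G)}
    (h : (u ++ v ++ s).IsChain NeutralLt) (hv : ∀ l ∈ v, l.deg = 0) :
    v.Pairwise fun l l' => l.idx < l'.idx := by
  have h1 : v.IsChain NeutralLt := (List.isChain_append.mp (List.isChain_append.mp h).1).2.1
  have h2 : v.IsChain fun l l' => l.idx < l'.idx := by
    clear h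
    induction h1 with
    | nil => exact List.IsChain.nil
    | singleton a => exact List.IsChain.singleton a
    | cons_cons hab h ih =>
      exact List.IsChain.cons_cons (hab (hv _ (by simp)) (hv _ (by simp)))
        (ih fun l hl => hv l (List.mem_cons_of_mem _ hl))
  have : IsTrans (Letter G) fun l l' => l.idx < l'.idx := ⟨fun _ _ _ => lt_trans⟩
  exact List.isChain_iff_pairwise.mp h2

theorem GoodBlocks.isChain (h : GoodBlocks F L M) : (blocks L M).IsChain NeutralLt := by
  obtain ⟨h1, -, h3, h4, -⟩ := h
  induction L with
  | nil => exact h4.isChain.imp fun _ _ h _ _ => h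
  | cons b L ih =>
    have hb := h1 b List.mem_cons_self
    have ih' := ih (fun b hb => h1 b (List.mem_cons_of_mem _ hb))
      (fun b hb => h3 b (List.mem_cons_of_mem _ hb))
    rw [blocks_cons, List.isChain_append]
    refine ⟨(h3 b List.mem_cons_self).isChain.imp fun _ _ h _ _ => h, ?_, ?_⟩
    · rw [List.isChain_cons]
      exact ⟨fun _ _ h => absurd h hb.2, ih'⟩
    · intro x _ y hy _ hy0
      obtain rfl : b.2 = y := by simpa using hy
      exact absurd hy0 hb.2

/-- The degree of a subword is that of the run of non-neutral letters in it. If it begins with a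
neutral letter d and its component is one-dimensional, the run is nonempty and begins in the block
of d, whose neutral word then has to be empty. -/
theorem GoodBlocks.locallyGood (hr : 1 ≤ r) (h : GoodBlocks F L M) :
    LocallyGood F (blocks L M) := by
  have h0 := finrank_zero_ne_one (F := F) hr
  have hnn : ∀ u d z s, blocks L M = u ++ d :: z ++ s → d.deg = 0 →
      Module.finrank F (finestComp F r (wdeg (d :: z))) ≠ 1 := by
    intro u d z s hw hd hdim
    rw [wdeg_cons, hd, zero_add] at hdim
    rw [List.append_assoc, List.cons_append] at hw
    rcases blocks_eq_append_neutral h.separated h.neutral hw hd with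
      ⟨P, b, Q, N, rfl, hdb, hN, ht⟩ | ht
    · have hsep : Separated ((N, b.2) :: Q) := by
        intro c hc
        rcases List.mem_cons.mp hc with rfl | hc
        · exact ⟨hN, (h.separated b (by simp)).2⟩
        · exact h.separated c (by simp [hc])
      obtain ⟨P', Q', h1, h2, -⟩ := exists_prefix_blocks (z := z) (s := s) hsep h.neutral
        (by rw [blocks_cons, ht])
      cases P' with
      | nil =>
        rw [h2] at hdim
        exact h0 hdim
      | cons c Z =>
        obtain ⟨rfl, rfl⟩ := List.cons.inj h1
        have := (h.segment P b Z Q' (by simp) (by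
          rw [h2, bdeg_cons] at hdim
          rwa [bdeg_cons])).1
        rw [this] at hdb
        exact absurd hdb List.not_mem_nil
    · rw [wdeg_eq_zero fun l hl => ht l (by simp [hl])] at hdim
      exact h0 hdim
  refine ⟨?_, hnn, ?_, ?_⟩
  · intro u v s hw
    exact pairwise_of_isChain_neutralLt (hw ▸ h.isChain)
  · intro u a z b s hw hb hdim
    have hne : a.deg ≠ 0 := fun ha => hnn u a (z ++ [b]) s (by simp [hw]) ha hdim
    obtain ⟨P, c, Q, rfl, rfl, ht⟩ := blocks_eq_append_nonneutral (u := u) (d := a)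
      (t := z ++ [b] ++ s) h.separated h.neutral (by simp [hw]) hne
    obtain ⟨P', Q', rfl, h2, -, h3⟩ := exists_prefix_blocks (z := z ++ [b]) (s := s)
      (L := Q) (fun c hc => h.separated c (by simp [hc])) h.neutral ht.symm
    obtain ⟨Z', b', rfl, rfl⟩ := h3 z b rfl hb
    refine (h.segment P c (Z' ++ [b']) Q' (by simp) ?_).2.2 Z' b' rfl
    rw [bdeg_cons, ← h2, ← wdeg_cons]
    exact hdim
  · intro a ha hdim
    have hne : a.deg ≠ 0 := fun ha => h0 (ha ▸ hdim)
    obtain ⟨u, t, hw⟩ := List.append_of_mem ha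
    obtain ⟨P, c, Q, rfl, rfl, ht⟩ := blocks_eq_append_nonneutral h.separated h.neutral hw hne
    refine (h.segment P c [] Q (by simp) ?_).2.1 rfl
    rwa [bdeg_cons, bdeg_nil, add_zero]

theorem LocallyGood.goodBlocks (h : LocallyGood F (blocks L M)) (hL : Separated L)
    (hM : ∀ l ∈ M, l.deg = 0) : GoodBlocks F L M := by
  refine ⟨hL, hM, ?_, ?_, ?_⟩
  · intro b hb
    obtain ⟨P, Q, rfl⟩ := List.append_of_mem hb
    exact h.sorted (blocks P []) b.1 (b.2 :: blocks Q M)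
      (by rw [blocks_append, blocks_cons, List.append_assoc]) (hL b hb).1
  · refine h.sorted (blocks L []) M [] ?_ hM
    simp [blocks]
  · rintro P b Z S rfl hdim
    have hw : blocks (P ++ (b :: Z) ++ S) M =
        blocks P [] ++ (b.1 ++ b.2 :: blocks Z [] ++ blocks S M) := by
      rw [List.append_assoc, blocks_append, blocks_append, blocks_cons]
    have hdeg : wdeg (b.2 :: blocks Z []) = bdeg (b :: Z) := by
      rw [wdeg_cons, wdeg_blocks (fun c hc => hL c (by simp [hc])) (by simp), bdeg_cons]
    refine ⟨?_, ?_, ?_⟩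
    · rcases List.eq_nil_or_concat b.1 with hb | ⟨N, d, hb⟩
      · exact hb
      · exfalso
        have hd : d.deg = 0 := (hL b (by simp)).1 d (by simp [hb])
        refine h.no_neutral (blocks P [] ++ N) d (b.2 :: blocks Z []) (blocks S M) ?_ hd ?_
        · rw [hw, hb]; simp
        · rw [wdeg_cons, hd, zero_add, hdeg, hdim]
    · rintro rfl
      refine h.unstarred b.2 (by rw [hw]; simp) ?_
      rwa [bdeg_cons, bdeg_nil, add_zero] at hdim
    · rintro Z' b' rfl
      have hZ : blocks (Z' ++ [b']) [] = blocks Z' [] ++ b'.1 ++ [b'.2] := by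
        rw [blocks_append, blocks_cons, blocks_nil, List.append_assoc]
      rw [hZ] at hw hdeg
      refine h.ends (blocks P [] ++ b.1) b.2 (blocks Z' [] ++ b'.1) b'.2 (blocks S M) ?_
        (hL b' (by simp)).2 ?_
      · rw [hw]; simp
      · rw [← hdim, ← hdeg]; simp

end LocallyGood

/-! ### Translation of the definition of good monomials into subwords. -/

section IsGood

variable {F : Type*} [Field F] {r n : ℕ}

theorem assemble_eq_blocks {G : Type} {k : ℕ} (M : Fin (k + 1) → List (Letter G))
    (y : Fin k → Letter G) : assemble M y =
      blocks (List.ofFn fun i => (M i.castSucc, y i)) (M (Fin.last k)) := by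
  simp [assemble, blocks, List.flatMap, List.map_ofFn, Function.comp_def]

/-- This matches the sums over index intervals in condition (III) with contiguous sublists of
blocks. -/
theorem sum_Icc_eq_of_ofFn_eq {A : Type*} [AddCommGroup A] {k : ℕ} {f : Fin k → A}
    {P Q S : List A} (h : List.ofFn f = P ++ Q ++ S) {i j : Fin k} (hi : i.val = P.length)
    (hj : j.val + 1 = P.length + Q.length) : ∑ l ∈ Finset.Icc i j, f l = Q.sum := by
  have h1 : ∀ l : Fin k, f l = (P ++ Q ++ S).getD l.val 0 := by
    intro l
    rw [← h, List.getD_eq_getElem _ _ (by simp)]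
    simp
  calc ∑ l ∈ Finset.Icc i j, f l
      = ∑ m ∈ Finset.Icc i.val j.val, (P ++ Q ++ S).getD m 0 := by
        rw [← Fin.map_valEmbedding_Icc, Finset.sum_map]
        exact Finset.sum_congr rfl fun l _ => h1 l
    _ = ∑ m ∈ Finset.range Q.length, (P ++ Q ++ S).getD (P.length + m) 0 := by
        rw [Finset.sum_bij' (fun m _ => m - P.length) (fun m _ => P.length + m)]
        · intro m hm
          rw [Finset.mem_Icc] at hm
          rw [Finset.mem_range]
          omega
        · intro m hm
          rw [Finset.mem_range] at hm
          rw [Finset.mem_Icc]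
          omega
        · intro m hm
          rw [Finset.mem_Icc] at hm
          omega
        · intro m hm
          omega
        · intro m hm
          rw [Finset.mem_Icc] at hm
          congr 1
          omega
    _ = ∑ m : Fin Q.length, Q[m] := by
        rw [Finset.sum_range]
        refine Finset.sum_congr rfl fun m _ => ?_
        rw [List.append_assoc, List.getD_append_right _ _ _ _ (by omega),
          List.getD_append _ _ _ _ (by have := m.2; omega), Nat.add_sub_cancel_left,
          List.getD_eq_getElem]
        rfl
    _ = Q.sum := by
        rw [← List.sum_ofFn]
        congr 1
        exact List.ofFn_getElem

theorem apply_eq_of_ofFn_eq {A : Type*} {k : ℕ} {f : Fin k → A} {P S : List A} {b : A}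
    (h : List.ofFn f = P ++ b :: S) {i : Fin k} (hi : i.val = P.length) : f i = b := by
  have h1 : (List.ofFn f)[i.val]? = (P ++ b :: S)[i.val]? := by rw [h]
  rw [hi] at h1
  simpa [← hi] using h1

theorem goodBlocks_ofFn {k : ℕ} {M : Fin (k + 1) → List (Letter (Fin r → ℤ))}
    {y : Fin k → Letter (Fin r → ℤ)} (h1 : ∀ i, ∀ l ∈ M i, l.deg = 0) (h2 : ∀ i, (y i).deg ≠ 0)
    (h3 : ∀ i, (M i).Pairwise fun l l' => l.idx < l'.idx)
    (h4 : ∀ i, Module.finrank F (finestComp F r (y i).deg) = 1 →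
      (y i).starred = false ∧ M i.castSucc = [])
    (h5 : ∀ i j, i < j →
      Module.finrank F (finestComp F r (∑ l ∈ Finset.Icc i j, (y l).deg)) = 1 →
      M i.castSucc = [] ∧ (y i).idx < (y j).idx) :
    GoodBlocks F (List.ofFn fun i => (M i.castSucc, y i)) (M (Fin.last k)) := by
  refine ⟨?_, h1 _, ?_, h3 _, ?_⟩
  · intro b hb
    obtain ⟨i, rfl⟩ := (List.mem_ofFn' _ _).mp hb
    exact ⟨h1 _, h2 i⟩
  · intro b hb
    obtain ⟨i, rfl⟩ := (List.mem_ofFn' _ _).mp hb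
    exact h3 _
  · intro P b Z S hL hdim
    have hk : k = P.length + (Z.length + 1) + S.length := by
      have := congrArg List.length hL
      simp only [List.length_ofFn, List.length_append, List.length_cons] at this
      exact this
    obtain ⟨i, hi⟩ : ∃ i : Fin k, i.val = P.length := ⟨⟨P.length, by omega⟩, rfl⟩
    obtain ⟨j, hj⟩ : ∃ j : Fin k, j.val = P.length + Z.length :=
      ⟨⟨P.length + Z.length, by omega⟩, rfl⟩
    have hb := apply_eq_of_ofFn_eq (P := P) (S := Z ++ S) (b := b) (by rw [hL]; simp) hi
    subst hb
    have hsum : ∑ l ∈ Finset.Icc i j, (y l).deg = _ :=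
      sum_Icc_eq_of_ofFn_eq (P := P.map fun b => b.2.deg) (Q := (_ :: Z).map fun b => b.2.deg)
        (S := S.map fun b => b.2.deg)
        (by rw [← List.map_append, ← List.map_append, ← hL, List.map_ofFn]; rfl)
        (by simp [hi]) (by simp [hj]; omega)
    rw [bdeg, ← hsum] at hdim
    rcases List.eq_nil_or_concat Z with rfl | ⟨Z', b', rfl⟩
    · obtain rfl : i = j := Fin.ext (by rw [hi, hj]; simp)
      rw [Finset.Icc_self, Finset.sum_singleton] at hdim
      obtain ⟨h6, h7⟩ := h4 _ hdim
      exact ⟨h7, fun _ => h6, fun Z' b' h => by simp at h⟩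
    · obtain ⟨h6, h7⟩ := h5 _ _ (by
        rw [Fin.lt_def, hi, hj]; simp) hdim
      refine ⟨h6, fun h => by simp at h, ?_⟩
      intro Z'' b'' hZ
      have hb := apply_eq_of_ofFn_eq (P := P ++ _ :: Z'') (S := S) (b := b'') (i := j)
        (by rw [hL, hZ]; simp; rfl) (by rw [hj, hZ]; simp)
      rw [← hb]
      exact h7

theorem GoodBlocks.isGood {w : List (Letter (Fin r → ℤ))}
    {L : List (List (Letter (Fin r → ℤ)) × Letter (Fin r → ℤ))} {M : List (Letter (Fin r → ℤ))}
    (h : GoodBlocks F L M) (hw : w = blocks L M) (hm : IsMultilinear n w)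
    (hT : mon F w ∉ sympIdentities F r) : IsGood F r n w := by
  -- The neutral words are indexed by one more value than the blocks; the last index takes the
  -- trailing word M.
  have hM : ∀ i : Fin (L.length + 1), ∀ P : List (Letter (Fin r → ℤ)) → Prop,
      (∀ b ∈ L, P b.1) → P M → P (if h : i.val < L.length then L[i.val].1 else M) := by
    intro i P h1 h2
    split_ifs
    · exact h1 _ (List.getElem_mem _)
    · exact h2
  refine ⟨hm, hT, L.length, fun i => if h : i.val < L.length then L[i.val].1 else M,
    fun i => L[i].2, ?_, ?_, ?_, ?_, ?_, ?_⟩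
  · rw [assemble_eq_blocks, hw]
    simp
  · exact fun i => hM i (fun N => ∀ l ∈ N, l.deg = 0) (fun b hb => (h.separated b hb).1) h.neutral
  · exact fun i => (h.separated _ (List.getElem_mem _)).2
  · exact fun i => hM i _ h.sorted h.sorted_last
  · intro i hdim
    obtain ⟨h1, h2, -⟩ := h.segment (L.take i) L[i] [] (L.drop (i + 1)) (by simp)
      (by rwa [bdeg_cons, bdeg_nil, add_zero])
    exact ⟨h2 rfl, by simpa using h1⟩
  · intro i j hij hdim
    have hij' : i.val < j.val := hij
    have hj := j.2
    have hL : L = L.take i ++ (L[i] :: ((L.take j).drop (i + 1) ++ [L[j]])) ++ L.drop (j + 1) := by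
      have e1 : L = L.take j ++ L[j] :: L.drop (j + 1) := by simp
      have e2 : L.take j = L.take i ++ L[i] :: (L.take j).drop (i + 1) := by
        have e3 : i.val < (L.take j).length := by rw [List.length_take]; omega
        conv_lhs => rw [← List.take_append_drop i.val (L.take j), List.drop_eq_getElem_cons e3]
        rw [List.take_take, min_eq_left hij'.le, List.getElem_take]
        rfl
      conv_lhs => rw [e1, e2]
      simp
    have hsum : ∑ l ∈ Finset.Icc i j, L[l].2.deg =
        bdeg (L[i] :: ((L.take j).drop (i + 1) ++ [L[j]])) := by
      refine sum_Icc_eq_of_ofFn_eq (P := (L.take i).map fun b => b.2.deg)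
        (S := (L.drop (j + 1)).map fun b => b.2.deg) ?_ ?_ ?_
      · rw [← List.map_append, ← List.map_append, ← hL]
        conv_rhs => rw [← List.ofFn_getElem (xs := L), List.map_ofFn]
        rfl
      · simp
      · simp; omega
    obtain ⟨h1, -, h2⟩ := h.segment _ _ _ _ hL (by rw [← hsum]; exact hdim)
    exact ⟨by simpa using h1, h2 _ _ rfl⟩

theorem isGood_iff (hr : 1 ≤ r) {w : List (Letter (Fin r → ℤ))} :
    IsGood F r n w ↔ IsMultilinear n w ∧ mon F w ∉ sympIdentities F r ∧ LocallyGood F w := by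
  constructor
  · rintro ⟨h1, h2, k, M, y, rfl, h3, h4, h5, h6, h7⟩
    refine ⟨h1, h2, ?_⟩
    rw [assemble_eq_blocks]
    exact (goodBlocks_ofFn h3 h4 h5 h6 h7).locallyGood hr
  · rintro ⟨h1, h2, h3⟩
    obtain ⟨L, M, rfl, h4, h5⟩ := exists_blocks w
    exact (h3.goodBlocks h4 h5).isGood rfl h1 h2

end IsGood
-- Rewriting multilinear monomials into good ones.
section Reduction

variable {F : Type*} [Field F] {r n : ℕ}
  {J : TwoSidedIdeal (FreeAlgebra F (Letter (Fin r → ℤ)))}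

/-- The keys of the letters: neutral letters come last, and the other letters are ordered by their
indices. -/
def key (n : ℕ) (l : Letter (Fin r → ℤ)) : ℕ :=
  (if l.deg = 0 then 2 * n + 2 else 0) + 2 * l.idx + if l.starred then 1 else 0

theorem IsMultilinear.nodup {w : List (Letter (Fin r → ℤ))} (h : IsMultilinear n w) :
    (w.map Letter.idx).Nodup :=
  h.nodup_iff.mpr List.nodup_range'

theorem IsMultilinear.idx_le {w : List (Letter (Fin r → ℤ))} (h : IsMultilinear n w)
    {l : Letter (Fin r → ℤ)} (hl : l ∈ w) : l.idx ≤ n := by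
  have := h.mem_iff.mp (List.mem_map_of_mem hl)
  rw [List.mem_range'_1] at this
  omega

theorem shortlex_key {u v v' s : List (Letter (Fin r → ℤ))} {a a' : Letter (Fin r → ℤ)}
    (hlen : v.length = v'.length) (h : key n a' < key n a) :
    List.Shortlex (· < ·) ((u ++ a' :: v' ++ s).map (key n)) ((u ++ a :: v ++ s).map (key n)) := by
  rw [List.append_assoc, List.append_assoc, List.map_append (l₁ := u), List.map_append (l₁ := u)]
  refine List.Shortlex.append_left ?_ _
  refine List.Shortlex.of_lex (by simp [hlen]) ?_
  exact List.Lex.rel h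

/-- Both d z and z have a degree with one-dimensional component, so modulo J one has d z ≡ -(d z)^*
= -z^* d^* ≡ z d^*. -/
theorem neutral_mul_sub_mem (hJ : IsTIdeal F J) (hb : ∀ f ∈ basicIdentities F r, f ∈ J)
    {d : Letter (Fin r → ℤ)} {z : List (Letter (Fin r → ℤ))} (hd : d.deg = 0)
    (hz : Module.finrank F (finestComp F r (wdeg z)) = 1) :
    mon F (d :: z) - mon F (z ++ [d.star]) ∈ J := by
  have h1 := freeInv_add_mem hJ hb (p := mon F (d :: z)) (g := wdeg z) hz (by
    have := mon_mem_freeComp (F := F) (d :: z)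
    rwa [wdeg_cons, hd, zero_add] at this)
  have h2 := J.mul_mem_right _ (mon F [d.star])
    (freeInv_add_mem hJ hb (p := mon F z) hz (mon_mem_freeComp z))
  have h3 := J.sub_mem h1 h2
  rw [mon_cons, freeInv_mul, freeInv_ι, mon_singleton] at h3
  rw [mon_cons, mon_append, mon_singleton]
  convert h3 using 1
  noncomm_ring

/-- Each violated condition provides a rewriting of a subword, up to J and a scalar, that lowers the
key of its first letter: swap two neutral letters, move a neutral letter to the right, apply the
involution to a whole subword, or remove a star. -/
theorem locallyGood_of_minimal (hr : 1 ≤ r) (hJ : IsTIdeal F J)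
    (hb : ∀ f ∈ basicIdentities F r, f ∈ J) {w : List (Letter (Fin r → ℤ))}
    (hm : IsMultilinear n w)
    (hmin : ∀ w' (c : F), IsMultilinear n w' → mon F w - c • mon F w' ∈ J →
      ¬ List.Shortlex (· < ·) (w'.map (key n)) (w.map (key n))) :
    LocallyGood F w := by
  have h0 := finrank_zero_ne_one (F := F) hr
  have hlocal : ∀ u a v s a' v', w = u ++ (a :: v) ++ s →
      ((a' :: v').map Letter.idx).Perm ((a :: v).map Letter.idx) →
      (∃ c : F, mon F (a :: v) - c • mon F (a' :: v') ∈ J) → ¬ key n a' < key n a := by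
    rintro u a v s a' v' rfl hperm ⟨c, hc⟩ hkey
    have hlen : v.length = v'.length := by
      have := hperm.length_eq
      simp only [List.length_map, List.length_cons] at this
      omega
    refine hmin (u ++ (a' :: v') ++ s) c ?_ ?_ (shortlex_key hlen hkey)
    · unfold IsMultilinear at hm ⊢
      refine List.Perm.trans ?_ hm
      rw [List.map_append, List.map_append, List.map_append, List.map_append]
      exact (hperm.append_left _).append_right _
    · have := J.mul_mem_right _ (mon F s) (J.mul_mem_left (mon F u) _ hc)
      rw [mon_append, mon_append, mon_append, mon_append]
      convert this using 1
      simp only [mul_sub, sub_mul, mul_smul_comm, smul_mul_assoc]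
  have hnn : ∀ z u d s, w = u ++ d :: z ++ s → d.deg = 0 →
      Module.finrank F (finestComp F r (wdeg (d :: z))) ≠ 1 := by
    intro z
    induction z with
    | nil =>
      intro u d s hw hd hdim
      rw [wdeg_cons, hd, zero_add, wdeg_nil] at hdim
      exact h0 hdim
    | cons k z ih =>
      intro u d s hw hd hdim
      rw [wdeg_cons, hd, zero_add] at hdim
      -- If the next letter is neutral as well, d can be dropped without changing the degree.
      -- Otherwise moving d behind the subword brings a non-neutral letter to the front.
      by_cases hk : k.deg = 0
      · exact ih (u ++ [d]) k s (by simp [hw]) hk hdim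
      · refine hlocal u d (k :: z) s k (z ++ [d.star]) hw ?_ ⟨1, ?_⟩ ?_
        · simpa using List.perm_append_comm (l₁ := k.idx :: z.map Letter.idx) (l₂ := [d.idx])
        · rw [one_smul, ← List.cons_append]
          exact neutral_mul_sub_mem hJ hb hd hdim
        -- Indices are at most n, so non-neutral keys are at most 2n + 1, below the offset 2n + 2 of
        -- the neutral ones.
        · have := hm.idx_le (l := k) (by simp [hw])
          unfold key
          rw [if_neg hk, if_pos hd]
          split_ifs <;> omega
  have hidx : ∀ a b, [a, b].Sublist w → a.idx ≠ b.idx := by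
    intro a b hab
    have := (hab.map Letter.idx).nodup hm.nodup
    simpa using this
  have hkey : ∀ a b : Letter (Fin r → ℤ), (a.deg = 0 ↔ b.deg = 0) → b.idx < a.idx →
      key n b < key n a := by
    intro a b hab hlt
    unfold key
    by_cases ha : a.deg = 0
    · rw [if_pos ha, if_pos (hab.mp ha)]
      split_ifs <;> omega
    · rw [if_neg ha, if_neg fun h => ha (hab.mpr h)]
      split_ifs <;> omega
  refine ⟨?_, fun u d z s => hnn z u d s, ?_, ?_⟩
  · intro u v s hw
    refine pairwise_of_isChain_neutralLt (u := u) (s := s) ?_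
    rw [← hw, List.isChain_iff_forall_rel_of_append_cons_cons]
    intro a b u s hw ha hb'
    have hne := hidx a b (by
      rw [hw]
      refine List.Sublist.trans ?_ (List.sublist_append_right _ _)
      simp)
    by_contra hlt
    refine hlocal u a [b] s b [a] (by simp [hw]) (by simpa using List.Perm.swap ..) ⟨1, ?_⟩
      (hkey a b (iff_of_true ha hb') (by omega))
    rw [one_smul, mon_cons, mon_singleton, mon_cons, mon_singleton]
    exact commutator_mem hJ hb (ha ▸ ι_mem_freeComp a) (hb' ▸ ι_mem_freeComp b)
  · intro u a z b s hw hb' hdim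
    have ha : a.deg ≠ 0 := fun ha => hnn (z ++ [b]) u a s (by simp [hw]) ha hdim
    have hne := hidx a b (by
      rw [hw]
      refine List.Sublist.trans ?_ (List.sublist_append_left _ _)
      refine List.Sublist.trans ?_ (List.sublist_append_right _ _)
      simp)
    by_contra hlt
    -- The involution reverses the subword up to the sign -1 and puts the smaller index of b in
    -- front.
    refine hlocal u a (z ++ [b]) s b.star (wordInv (a :: z)) (by simp [hw]) ?_ ⟨-1, ?_⟩
      (hkey a b.star (iff_of_false ha hb') (by rw [Letter.star_idx]; omega))
    · have : b.star :: wordInv (a :: z) = wordInv (a :: (z ++ [b])) := by simp [wordInv]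
      rw [this, wordInv, List.map_reverse, List.map_map]
      exact List.reverse_perm _
    · have : b.star :: wordInv (a :: z) = wordInv (a :: (z ++ [b])) := by simp [wordInv]
      rw [this, neg_one_smul, sub_neg_eq_add, ← freeInv_mon, add_comm]
      exact freeInv_add_mem hJ hb hdim (mon_mem_freeComp _)
  · intro a ha hdim
    by_contra hs
    obtain ⟨u, s, hw⟩ := List.append_of_mem ha
    refine hlocal u a [] s a.star [] (by simp [hw]) (by simp) ⟨-1, ?_⟩ ?_
    · rw [neg_one_smul, sub_neg_eq_add, mon_singleton, mon_singleton, add_comm, ← freeInv_ι]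
      exact freeInv_add_mem hJ hb hdim (ι_mem_freeComp a)
    · have hs' : a.starred = true := by simpa using hs
      by_cases h0' : a.deg = 0 <;> simp [key, h0', hs']

/-- The good monomials as elements of the free algebra. -/
def goodMon (F : Type*) [Field F] (r n : ℕ) (w : {w : List (Letter (Fin r → ℤ)) // IsGood F r n w}) :
    FreeAlgebra F (Letter (Fin r → ℤ)) := mon F w.1

theorem exists_good_mon_sub_mem (hr : 1 ≤ r) (hJ : IsTIdeal F J)
    (hb : ∀ f ∈ basicIdentities F r, f ∈ J)
    (hmon : ∀ w, (w.map Letter.idx).Nodup → mon F w ∈ sympIdentities F r → mon F w ∈ J) {w : List (Letter (Fin r → ℤ))}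
    (hm : IsMultilinear n w) :
    ∃ g ∈ Submodule.span F (Set.range (goodMon F r n)), mon F w - g ∈ J := by
  have hwf : WellFounded (InvImage (List.Shortlex (· < ·))
      (List.map (key (r := r) n))) := InvImage.wf _ (List.Shortlex.wf wellFounded_lt)
  induction w using hwf.induction with
  | _ w ih =>
    by_cases hT : mon F w ∈ sympIdentities F r
    · exact ⟨0, Submodule.zero_mem _, by rw [sub_zero]; exact hmon w hm.nodup hT⟩
    by_cases hg : LocallyGood F w
    · refine ⟨mon F w, Submodule.subset_span ⟨⟨w, (isGood_iff hr).mpr ⟨hm, hT, hg⟩⟩, rfl⟩, ?_⟩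
      rw [sub_self]
      exact J.zero_mem
    · have : ¬ ∀ w' (c : F), IsMultilinear n w' → mon F w - c • mon F w' ∈ J →
          ¬ List.Shortlex (· < ·) (w'.map (key n)) (w.map (key n)) :=
        fun h => hg (locallyGood_of_minimal hr hJ hb hm h)
      push Not at this
      obtain ⟨w', c, hm', hc, hlt⟩ := this
      obtain ⟨g, hg, hg'⟩ := ih w' hlt hm'
      refine ⟨c • g, Submodule.smul_mem _ _ hg, ?_⟩
      have h1 := J.add_mem hc (smul_mem_twoSided J c hg')
      rwa [smul_sub, sub_add_sub_cancel] at h1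

theorem exists_good_sub_mem (hr : 1 ≤ r) (hJ : IsTIdeal F J)
    (hb : ∀ f ∈ basicIdentities F r, f ∈ J)
    (hmon : ∀ w, (w.map Letter.idx).Nodup → mon F w ∈ sympIdentities F r → mon F w ∈ J)
    {f : FreeAlgebra F (Letter (Fin r → ℤ))} (hf : f ∈ multilinearSpace F (Fin r → ℤ) n) :
    ∃ g ∈ Submodule.span F (Set.range (goodMon F r n)), f - g ∈ J := by
  induction hf using Submodule.span_induction with
  | mem f hf =>
    obtain ⟨w, hw, rfl⟩ := hf
    exact exists_good_mon_sub_mem hr hJ hb hmon hw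
  | zero => exact ⟨0, Submodule.zero_mem _, by rw [sub_zero]; exact J.zero_mem⟩
  | add f f' _ _ hf hf' =>
    obtain ⟨g, hg, h⟩ := hf
    obtain ⟨g', hg', h'⟩ := hf'
    refine ⟨g + g', Submodule.add_mem _ hg hg', ?_⟩
    rw [add_sub_add_comm]
    exact J.add_mem h h'
  | smul c f _ hf =>
    obtain ⟨g, hg, h⟩ := hf
    refine ⟨c • g, Submodule.smul_mem _ _ hg, ?_⟩
    rw [← smul_sub]
    exact smul_mem_twoSided J c h

end Reduction

/-! ### Linear independence of good monomials and the basis. -/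

section Independence

variable {F : Type*} [Field F] {r n : ℕ}

/-- An entry of the value of a polynomial. -/
noncomputable def entryEval (a : ℕ → (Fin r → ℤ) → UT F (2 * r)) (p q : Fin (2 * r)) :
    FreeAlgebra F (Letter (Fin r → ℤ)) →ₗ[F] F where
  toFun f := (evalAt (symplectic F) a f : Matrix (Fin (2 * r)) (Fin (2 * r)) F) p q
  map_add' f g := by rw [map_add]; rfl
  map_smul' c f := by rw [map_smul]; rfl

/-- The coefficient of w is isolated by the substitution read off a walk of w: at its end points w
has a nonzero entry, and by `LocallyGood.unique` every other good word has entry 0. -/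
theorem goodMon_independent (hr : 1 ≤ r)
    (l : {w : List (Letter (Fin r → ℤ)) // IsGood F r n w} →₀ F)
    (h : Finsupp.linearCombination F (goodMon F r n) l ∈ sympIdentities F r) : l = 0 := by
  ext w
  rw [Finsupp.zero_apply]
  obtain ⟨hm, hT, hg⟩ := (isGood_iff hr).mp w.2
  obtain ⟨p, q, hpq⟩ := exists_walk_of_notMem hT
  obtain ⟨e, he⟩ := exists_edges hpq hm.nodup
  obtain ⟨c, hc, hev⟩ := he.eval (F := F)
  have h1 : entryEval (edgeSubst F e) p q (Finsupp.linearCombination F (goodMon F r n) l) = 0 := by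
    change (evalAt (symplectic F) (edgeSubst F e) _ : Matrix (Fin (2 * r)) (Fin (2 * r)) F) p q = 0
    rw [h _ edgeSubst_mem]
    rfl
  rw [Finsupp.linearCombination_apply, map_finsuppSum, Finsupp.sum_eq_single w] at h1
  · rw [map_smul, smul_eq_mul] at h1
    refine (mul_eq_zero.mp h1).resolve_right ?_
    change (evalAt (symplectic F) (edgeSubst F e) (mon F w.1) :
      Matrix (Fin (2 * r)) (Fin (2 * r)) F) p q ≠ 0
    rw [hev]
    exact hc
  · intro w' _ hne
    rw [map_smul, smul_eq_mul]
    refine mul_eq_zero_of_right _ ?_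
    by_contra h2
    have h3 : Walk (EStep e) p w'.1 q := walk_of_edgeSubst_ne_zero (F := F) h2
    obtain ⟨hm', -, hg'⟩ := (isGood_iff hr).mp w'.2
    exact hne (Subtype.ext (hg'.unique hg h3 he hm'.nodup (hm'.trans hm.symm)))
  · intro _
    rw [zero_smul, map_zero]

/-- Modulo J the polynomial is a combination of good monomials. As J consists of identities, so is
that combination, and it vanishes by independence. -/
theorem mem_of_mem_multilinearSpace {J : TwoSidedIdeal (FreeAlgebra F (Letter (Fin r → ℤ)))}
    (hr : 1 ≤ r) (hJ : IsTIdeal F J) (hb : ∀ f ∈ basicIdentities F r, f ∈ J)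
    (hmon : ∀ w, (w.map Letter.idx).Nodup → mon F w ∈ sympIdentities F r → mon F w ∈ J)
    (hJT : ∀ f ∈ J, f ∈ sympIdentities F r)
    {f : FreeAlgebra F (Letter (Fin r → ℤ))} (hf : f ∈ multilinearSpace F (Fin r → ℤ) n)
    (hfT : f ∈ sympIdentities F r) : f ∈ J := by
  obtain ⟨g, hg, hfg⟩ := exists_good_sub_mem hr hJ hb hmon hf
  obtain ⟨l, rfl⟩ := (Finsupp.mem_span_range_iff_exists_finsupp (R := F)).mp hg
  have h1 : Finsupp.linearCombination F (goodMon F r n) l ∈ sympIdentities F r := by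
    have := Submodule.sub_mem _ hfT (hJT _ hfg)
    rwa [sub_sub_cancel] at this
  rw [goodMon_independent hr l h1] at hfg
  simpa using hfg

theorem exists_basis (hr : 1 ≤ r) (n : ℕ) :
    ∃ b : Module.Basis {w : List (Letter (Fin r → ℤ)) // IsGood F r n w} F
      (multilinearQuotient F r n), ∀ w, b w = goodClass F w := by
  let v : {w : List (Letter (Fin r → ℤ)) // IsGood F r n w} →
      multilinearSpace F (Fin r → ℤ) n := fun w =>
    ⟨mon F w.1, Submodule.subset_span ⟨w.1, w.2.1, rfl⟩⟩
  have hv : ∀ w, goodClass F w = Submodule.mkQ _ (v w) := fun _ => rfl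
  have hli : LinearIndependent F (goodClass F (r := r) (n := n)) := by
    rw [linearIndependent_iff]
    intro l hl
    refine goodMon_independent hr l ?_
    have h1 : Finsupp.linearCombination F (goodClass F (r := r) (n := n)) l =
        Submodule.mkQ _ (Finsupp.linearCombination F v l) := by
      rw [Finsupp.apply_linearCombination]
      rfl
    rw [h1, Submodule.mkQ_apply, Submodule.Quotient.mk_eq_zero] at hl
    have h2 : (multilinearSpace F (Fin r → ℤ) n).subtype (Finsupp.linearCombination F v l) =
        Finsupp.linearCombination F (goodMon F r n) l := by
      rw [Finsupp.apply_linearCombination]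
      rfl
    rw [← h2]
    exact hl
  have hspan : ⊤ ≤ Submodule.span F (Set.range (goodClass F (r := r) (n := n))) := by
    rintro f -
    obtain ⟨⟨f, hf⟩, rfl⟩ := Submodule.mkQ_surjective _ f
    obtain ⟨g, hg, hfg⟩ := exists_good_sub_mem (J := sympIdeal F r) hr isTIdeal_sympIdeal
      (fun f hf => mem_sympIdeal.mpr (basicIdentities_subset hf))
      (fun w _ hw => mem_sympIdeal.mpr hw) hf
    obtain ⟨l, rfl⟩ := (Finsupp.mem_span_range_iff_exists_finsupp (R := F)).mp hg
    rw [Finsupp.mem_span_range_iff_exists_finsupp]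
    refine ⟨l, ?_⟩
    rw [mem_sympIdeal] at hfg
    have h1 : (l.sum fun w c => c • goodClass F w) =
        Submodule.mkQ _ (l.sum fun w c => c • v w) := by
      rw [map_finsuppSum]
      rfl
    rw [h1, eq_comm, ← sub_eq_zero, ← map_sub, Submodule.mkQ_apply,
      Submodule.Quotient.mk_eq_zero]
    have h2 : (multilinearSpace F (Fin r → ℤ) n).subtype (l.sum fun w c => c • v w) =
        l.sum fun w c => c • goodMon F r n w := by
      rw [map_finsuppSum]
      rfl
    change (multilinearSpace F (Fin r → ℤ) n).subtype (⟨f, hf⟩ - l.sum fun w c => c • v w) ∈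
      sympIdentities F r
    rw [map_sub, h2]
    exact hfg
  exact ⟨Module.Basis.mk hli hspan, fun w => Module.Basis.mk_apply hli hspan w⟩

end Independence

/-! ### Finitely many monomials generate the monomial identities. -/

section Monomials

/-- The word `x_{k,g_1} x_{k+1,g_2} ⋯`. -/
def stdWord {G : Type} : ℕ → List G → List (Letter G)
  | _, [] => []
  | k, g :: gs => ⟨k, g, false⟩ :: stdWord (k + 1) gs

variable {F : Type*} [Field F] {r : ℕ}

theorem walk_of_neutral {w : List (Letter (Fin r → ℤ))} (h : ∀ l ∈ w, l.deg = 0)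
    (p : Fin (2 * r)) : Walk DStep p w p := by
  induction w with
  | nil => rfl
  | cons l w ih =>
    exact ⟨p, ⟨le_rfl, by rw [h l List.mem_cons_self, sub_self]⟩,
      ih fun l hl => h l (List.mem_cons_of_mem _ hl)⟩

variable {L : List (List (Letter (Fin r → ℤ)) × Letter (Fin r → ℤ))}
  {M : List (Letter (Fin r → ℤ))}

theorem Walk.blocks {k : ℕ} {p q : Fin (2 * r)} (hL : Separated L) (hM : ∀ l ∈ M, l.deg = 0)
    (h : Walk DStep p (stdWord k (L.map fun b => b.2.deg)) q) : Walk DStep p (blocks L M) q := by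
  induction L generalizing k p with
  | nil =>
    rw [List.map_nil, stdWord, walk_nil] at h
    subst h
    exact walk_of_neutral hM p
  | cons b L ih =>
    obtain ⟨s, h1, h2⟩ := h
    rw [blocks_cons]
    exact walk_append.mpr ⟨p, walk_of_neutral (hL b List.mem_cons_self).1 p, s, h1,
      ih (fun b hb => hL b (List.mem_cons_of_mem _ hb)) h2⟩

/-- A non-neutral letter strictly raises the vertex, so a walk contains fewer than 2r of them. -/
theorem Walk.add_length_le {k : ℕ} {p q : Fin (2 * r)} (hL : Separated L)
    (h : Walk DStep p (stdWord k (L.map fun b => b.2.deg)) q) : p.val + L.length ≤ q.val := by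
  induction L generalizing k p with
  | nil =>
    rw [List.map_nil, stdWord, walk_nil] at h
    simp [h]
  | cons b L ih =>
    obtain ⟨s, h1, h2⟩ := h
    have h3 := ih (fun b hb => hL b (List.mem_cons_of_mem _ hb)) h2
    have h4 : p ≠ s := fun h =>
      (hL b List.mem_cons_self).2 (h1.deg_eq_zero_iff.mpr h)
    have h5 : p < s := lt_of_le_of_ne h1.1 h4
    rw [Fin.lt_def] at h5
    rw [List.length_cons]
    omega

theorem subst_stdWord {p : ℕ → (Fin r → ℤ) → FreeAlgebra F (Letter (Fin r → ℤ))} {k : ℕ}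
    (h : ∀ i b, L[i]? = some b → p (k + i) b.2.deg = mon F (b.1 ++ [b.2])) :
    subst p (mon F (stdWord k (L.map fun b => b.2.deg))) = mon F (blocks L []) := by
  induction L generalizing k with
  | nil => rw [List.map_nil, stdWord, mon_nil, map_one, blocks_nil, mon_nil]
  | cons b L ih =>
    have h1 := h 0 b rfl
    have h2 := ih (k := k + 1) fun i c hc => by
      rw [← h (i + 1) c (by simpa using hc), add_assoc, add_comm 1 i]
    rw [List.map_cons, stdWord, mon_cons, map_mul, h2, subst_ι, if_neg (by simp), blocks_cons,
      List.append_cons, mon_append, ← h1, add_zero]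

/-- The monomial identities among the words `x_{0,g_0} x_{1,g_1} ⋯` of length at most `2r` in
indeterminates whose degrees belong to the support of the grading. -/
def monomialIdentities (F : Type*) [Field F] (r : ℕ) : Set (List (Letter (Fin r → ℤ))) :=
  {w | mon F w ∈ sympIdentities F r} ∩
    (fun ps : List (Fin (2 * r) × Fin (2 * r)) =>
      stdWord 0 (ps.map fun p => finestTuple r p.1 - finestTuple r p.2)) ''
      {ps | ps.length ≤ 2 * r}

theorem finite_monomialIdentities : (monomialIdentities F r).Finite :=
  ((List.finite_length_le _ _).image _).inter_of_right _

theorem exists_degree_of_comp_ne_bot {g : Fin r → ℤ} (h : finestComp F r g ≠ ⊥) :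
    ∃ p : Fin (2 * r) × Fin (2 * r), finestTuple r p.1 - finestTuple r p.2 = g := by
  by_contra hc
  push Not at hc
  refine h ((Submodule.eq_bot_iff _).mpr fun A hA => UT.ext' fun i j => hA i j (hc (i, j)))

/-- Unless some letter has a degree with zero component, w arises from a word of
`monomialIdentities` by inserting neutral words and multiplying by a remainder on the right. -/
theorem mon_mem_of_mem_sympIdentities {J : TwoSidedIdeal (FreeAlgebra F (Letter (Fin r → ℤ)))}
    (hJ : IsTIdeal F J) (hb : ∀ f ∈ basicIdentities F r, f ∈ J)
    (hN : ∀ w ∈ monomialIdentities F r, mon F w ∈ J)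
    {w : List (Letter (Fin r → ℤ))} (hnd : (w.map Letter.idx).Nodup)
    (hw : mon F w ∈ sympIdentities F r) : mon F w ∈ J := by
  by_cases hsupp : ∃ l ∈ w, finestComp F r l.deg = ⊥
  · obtain ⟨l, hl, hbot⟩ := hsupp
    obtain ⟨u, s, rfl⟩ := List.append_of_mem hl
    rw [mon_append, mon_cons]
    exact J.mul_mem_left _ _ (J.mul_mem_right _ _
      (mem_of_comp_eq_bot hJ hb hbot (ι_mem_freeComp l)))
  push Not at hsupp
  obtain ⟨L, M, rfl, hL, hM⟩ := exists_blocks w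
  have hsplit : blocks L M = blocks (L.take (2 * r)) [] ++ blocks (L.drop (2 * r)) M := by
    rw [← blocks_append, List.take_append_drop]
  have hsep : Separated (L.take (2 * r)) := fun b hb => hL b (List.mem_of_mem_take hb)
  set K := L.take (2 * r) with hK
  -- A walk along K has fewer than 2r steps, so nothing was truncated and K = L. Inserting the
  -- neutral letters as loops would give a walk along the given word.
  have hT : mon F (stdWord 0 (K.map fun b => b.2.deg)) ∈ sympIdentities F r := by
    by_contra hT
    obtain ⟨p, q, hpq⟩ := exists_walk_of_notMem hT
    have hlen := hpq.add_length_le hsep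
    have hq := q.2
    have hKL : K = L := by
      rw [hK, List.take_eq_self_iff]
      by_contra hlt
      have : K.length = 2 * r := by rw [hK, List.length_take]; omega
      omega
    rw [hKL] at hpq
    exact notMem_of_walk (hpq.blocks hL hM) hnd hw
  have hdeg : ∀ b ∈ K, ∃ p : Fin (2 * r) × Fin (2 * r),
      finestTuple r p.1 - finestTuple r p.2 = b.2.deg := by
    intro b hb
    refine exists_degree_of_comp_ne_bot (F := F) (hsupp b.2 ?_)
    obtain ⟨P, Q, hPQ⟩ := List.append_of_mem (List.mem_of_mem_take hb)
    rw [hPQ, blocks_append, blocks_cons]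
    simp
  have hps : ∀ K : List (List (Letter (Fin r → ℤ)) × Letter (Fin r → ℤ)),
      (∀ b ∈ K, ∃ p : Fin (2 * r) × Fin (2 * r),
      finestTuple r p.1 - finestTuple r p.2 = b.2.deg) →
      ∃ ps : List (Fin (2 * r) × Fin (2 * r)), ps.length = K.length ∧
      (ps.map fun p => finestTuple r p.1 - finestTuple r p.2) = K.map fun b => b.2.deg := by
    intro K hK
    induction K with
    | nil => exact ⟨[], rfl, rfl⟩
    | cons b K ih =>
      obtain ⟨p, hp⟩ := hK b List.mem_cons_self
      obtain ⟨ps, h1, h2⟩ := ih fun b hb => hK b (List.mem_cons_of_mem _ hb)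
      exact ⟨p :: ps, by simp [h1], by simp [h2, hp]⟩
  obtain ⟨ps, hps1, hps2⟩ := hps K hdeg
  have hmem : mon F (stdWord 0 (K.map fun b => b.2.deg)) ∈ J := by
    refine hN _ ⟨hT, ps, ?_, by rw [← hps2]⟩
    change ps.length ≤ 2 * r
    rw [hps1, hK, List.length_take]
    exact min_le_left _ _
  classical
  -- The i-th indeterminate goes to the whole block M_i y_i, which has the degree of y_i.
  have hφ := hJ.2 _ (isGradedInvEnd_subst (p := fun i g =>
    match K[i]? with
    | some b => if b.2.deg = g then mon F (b.1 ++ [b.2]) else 0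
    | none => 0) (by
      intro i g
      rcases h : K[i]? with _ | b
      · exact Submodule.zero_mem _
      · dsimp only
        split_ifs with hg
        · rw [← hg]
          have h1 := mon_mem_freeComp (F := F) (b.1 ++ [b.2])
          rwa [wdeg_append, wdeg_eq_zero (hsep b (List.mem_of_getElem? h)).1, wdeg_cons, wdeg_nil,
            zero_add, add_zero] at h1
        · exact Submodule.zero_mem _)) _ hmem
  rw [subst_stdWord] at hφ
  · rw [hsplit, mon_append]
    exact J.mul_mem_right _ _ hφ
  · intro i b hb
    rw [zero_add, hb]
    simp

end Monomials

/-! ### Polarization: reduction of all identities to multilinear ones. -/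

section Polarization

variable {F : Type*} [Field F] {r n : ℕ} {c : Fin n → ℕ × (Fin r → ℤ)}

/-- The index and the degree of a letter. -/
def Letter.label (l : Letter (Fin r → ℤ)) : ℕ × (Fin r → ℤ) := (l.idx, l.deg)

/-- The sum of `φ` over all lists `ks` whose labels under `c` are the labels of `w`. -/
def labelSum {V : Type*} [AddCommMonoid V] (c : Fin n → ℕ × (Fin r → ℤ)) :
    List (Letter (Fin r → ℤ)) → (List (Fin n) → V) → V
  | [], φ => φ []
  | l :: w, φ => ∑ k with c k = l.label, labelSum c w fun ks => φ (k :: ks)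

/-- The word `w` with its indices replaced by the successors of the entries of `ks`. -/
def relabel (w : List (Letter (Fin r → ℤ))) (ks : List (Fin n)) : List (Letter (Fin r → ℤ)) :=
  List.zipWith (fun l k => ⟨k.val + 1, l.deg, l.starred⟩) w ks

theorem map_labelSum {V V' : Type*} [AddCommMonoid V] [AddCommMonoid V'] (h : V →+ V')
    (w : List (Letter (Fin r → ℤ))) (φ : List (Fin n) → V) :
    h (labelSum c w φ) = labelSum c w fun ks => h (φ ks) := by
  induction w generalizing φ with
  | nil => rfl
  | cons l w ih =>
    rw [labelSum, labelSum, map_sum]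
    exact Finset.sum_congr rfl fun k _ => ih _

theorem labelSum_congr {V : Type*} [AddCommMonoid V] {w : List (Letter (Fin r → ℤ))}
    {φ ψ : List (Fin n) → V} (h : ∀ ks, ks.map c = w.map Letter.label → φ ks = ψ ks) :
    labelSum c w φ = labelSum c w ψ := by
  induction w generalizing φ ψ with
  | nil => exact h [] rfl
  | cons l w ih =>
    rw [labelSum, labelSum]
    refine Finset.sum_congr rfl fun k hk => ih fun ks hks => h _ ?_
    rw [List.map_cons, List.map_cons, hks, (Finset.mem_filter.mp hk).2]

theorem labelSum_mem {V : Type*} [AddCommGroup V] [Module F V] {S : Submodule F V}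
    {w : List (Letter (Fin r → ℤ))} {φ : List (Fin n) → V}
    (h : ∀ ks, ks.map c = w.map Letter.label → φ ks ∈ S) : labelSum c w φ ∈ S := by
  induction w generalizing φ with
  | nil => exact h [] rfl
  | cons l w ih =>
    rw [labelSum]
    refine Submodule.sum_mem _ fun k hk => ih fun ks hks => h _ ?_
    rw [List.map_cons, List.map_cons, hks, (Finset.mem_filter.mp hk).2]

theorem le_labelSum {w : List (Letter (Fin r → ℤ))} {φ : List (Fin n) → ℕ} {ks : List (Fin n)}
    (h : ks.map c = w.map Letter.label) : φ ks ≤ labelSum c w φ := by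
  induction w generalizing φ ks with
  | nil =>
    rw [List.map_nil, List.map_eq_nil_iff] at h
    rw [h, labelSum]
  | cons l w ih =>
    cases ks with
    | nil => simp at h
    | cons k ks =>
      rw [List.map_cons, List.map_cons, List.cons.injEq] at h
      rw [labelSum]
      refine (ih (φ := fun ks => φ (k :: ks)) h.2).trans ?_
      exact Finset.single_le_sum (f := fun k => labelSum c w fun ks => φ (k :: ks))
        (fun _ _ => Nat.zero_le _) (Finset.mem_filter.mpr ⟨Finset.mem_univ k, h.1⟩)

/-- The multidegree of a list. -/
noncomputable def multidegree (ks : List (Fin n)) : Fin n →₀ ℕ :=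
  (ks.map fun k => Finsupp.single k 1).sum

theorem multidegree_cons (k : Fin n) (ks : List (Fin n)) :
    multidegree (k :: ks) = Finsupp.single k 1 + multidegree ks := by
  simp [multidegree]

theorem multidegree_apply (ks : List (Fin n)) (k : Fin n) : multidegree ks k = ks.count k := by
  induction ks with
  | nil => rfl
  | cons a ks ih =>
    rw [multidegree_cons, Finsupp.add_apply, ih, List.count_cons, Finsupp.single_apply, add_comm]
    simp

theorem perm_of_multidegree_eq {ks ks' : List (Fin n)} (h : multidegree ks = multidegree ks') :
    ks.Perm ks' := by
  rw [List.perm_iff_count]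
  intro k
  rw [← multidegree_apply, ← multidegree_apply, h]

open Classical in
/-- The component of degree one in each of the variables of the linearization of a word. -/
noncomputable def polarize (F : Type*) [Field F] {r n : ℕ} (c : Fin n → ℕ × (Fin r → ℤ))
    (w : List (Letter (Fin r → ℤ))) : FreeAlgebra F (Letter (Fin r → ℤ)) :=
  labelSum c w fun ks =>
    if multidegree ks = multidegree (List.finRange n) then mon F (relabel w ks) else 0

theorem relabel_idx {w : List (Letter (Fin r → ℤ))} {ks : List (Fin n)}
    (h : ks.length = w.length) : (relabel w ks).map Letter.idx = ks.map fun k => k.val + 1 := by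
  induction w generalizing ks with
  | nil =>
    rw [List.length_nil, List.length_eq_zero_iff] at h
    rw [h]; rfl
  | cons l w ih =>
    cases ks with
    | nil => simp at h
    | cons k ks =>
      have := ih (ks := ks) (by simpa using h)
      simpa [relabel] using this

theorem polarize_mem (w : List (Letter (Fin r → ℤ))) :
    polarize F c w ∈ multilinearSpace F (Fin r → ℤ) n := by
  refine labelSum_mem fun ks hks => ?_
  split_ifs with h
  · refine Submodule.subset_span ⟨_, ?_, rfl⟩
    have hlen : ks.length = w.length := by simpa using congrArg List.length hks
    unfold IsMultilinear
    rw [relabel_idx hlen]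
    refine ((perm_of_multidegree_eq h).map _).trans ?_
    rw [List.perm_iff_count]
    intro i
    congr 1
    refine List.ext_getElem (by simp) ?_
    intro i h1 h2
    simp [add_comm]
  · exact Submodule.zero_mem _

section Evaluation

variable (a : ℕ → (Fin r → ℤ) → UT F (2 * r))

/-- The generic linear combinations of the values of the indeterminates of index `1, …, n`. -/
noncomputable def linComb (c : Fin n → ℕ × (Fin r → ℤ)) (t : Fin n → F) (i : ℕ)
    (g : Fin r → ℤ) : UT F (2 * r) :=
  ∑ k with c k = (i, g), t k • a (k.val + 1) g

theorem symplectic_sum {ι : Type*} (s : Finset ι) (f : ι → UT F (2 * r)) :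
    symplectic F (∑ k ∈ s, f k) = ∑ k ∈ s, symplectic F (f k) := by
  classical
  induction s using Finset.induction_on with
  | empty => simp [symplectic_zero]
  | insert k s hk ih => rw [Finset.sum_insert hk, Finset.sum_insert hk, symplectic_add, ih]

/-- Multiplying out the linear combinations yields one term for each choice of a k with the right
label at every letter. -/
theorem evalAt_linComb (t : Fin n → F) (w : List (Letter (Fin r → ℤ))) :
    evalAt (symplectic F) (linComb a c t) (mon F w) =
      labelSum c w fun ks => (ks.map t).prod • evalAt (symplectic F) a (mon F (relabel w ks)) := by
  induction w with
  | nil => simp [labelSum, relabel]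
  | cons l w ih =>
    have h1 : evalAt (symplectic F) (linComb a c t) (FreeAlgebra.ι F l) =
        ∑ k with c k = l.label,
          t k • evalAt (symplectic F) a (FreeAlgebra.ι F ⟨k.val + 1, l.deg, l.starred⟩) := by
      rw [evalAt_ι]
      split_ifs with hs
      · rw [linComb, symplectic_sum]
        refine Finset.sum_congr rfl fun k _ => ?_
        rw [symplectic_smul, evalAt_ι, if_pos hs]
      · refine Finset.sum_congr rfl fun k _ => ?_
        rw [evalAt_ι, if_neg hs]
    rw [mon_cons, map_mul, h1, ih, labelSum, Finset.sum_mul]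
    refine Finset.sum_congr rfl fun k _ => ?_
    have h2 := map_labelSum (c := c) (AddMonoidHom.mulLeft
      (t k • evalAt (symplectic F) a (FreeAlgebra.ι F ⟨k.val + 1, l.deg, l.starred⟩))) w
      fun ks => (ks.map t).prod • evalAt (symplectic F) a (mon F (relabel w ks))
    rw [AddMonoidHom.coe_mulLeft] at h2
    rw [h2]
    refine labelSum_congr fun ks _ => ?_
    have h3 : relabel (l :: w) (k :: ks) = ⟨k.val + 1, l.deg, l.starred⟩ :: relabel w ks := rfl
    rw [h3, mon_cons, map_mul, List.map_cons, List.prod_cons, smul_mul_smul_comm]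

theorem eval_monomial_multidegree (t : Fin n → F) (ks : List (Fin n)) (e : F) :
    MvPolynomial.eval t (MvPolynomial.monomial (multidegree ks) e) = (ks.map t).prod * e := by
  induction ks generalizing e with
  | nil => simp [multidegree]
  | cons k ks ih =>
    have : MvPolynomial.monomial (multidegree (k :: ks)) e =
        MvPolynomial.X k * MvPolynomial.monomial (multidegree ks) e := by
      rw [multidegree_cons, MvPolynomial.X, MvPolynomial.monomial_mul, one_mul]
    rw [this, map_mul, ih, MvPolynomial.eval_X, List.map_cons, List.prod_cons, mul_assoc]

theorem entryEval_eq_zero {a : ℕ → (Fin r → ℤ) → UT F (2 * r)}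
    (ha : ∀ i g, a i g ∈ finestComp F r g) {f : FreeAlgebra F (Letter (Fin r → ℤ))}
    (hf : f ∈ sympIdentities F r) (p q : Fin (2 * r)) : entryEval a p q f = 0 := by
  have h : evalAt (symplectic F) a f = 0 := hf a ha
  change (evalAt (symplectic F) a f : Matrix (Fin (2 * r)) (Fin (2 * r)) F) p q = 0
  rw [h]
  rfl

/-- An entry of the value at the generic linear combinations is a polynomial in the parameters t
that vanishes everywhere, hence is zero over an infinite field. Its coefficient at the product of
all t_k is the entry of the polarization. -/
theorem polarize_sum_mem [Infinite F] {s : Finset (List (Letter (Fin r → ℤ)))}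
    {α : List (Letter (Fin r → ℤ)) → F} (h : ∑ w ∈ s, α w • mon F w ∈ sympIdentities F r) :
    ∑ w ∈ s, α w • polarize F c w ∈ sympIdentities F r := by
  classical
  intro a ha
  refine UT.ext' fun p q => ?_
  change entryEval a p q _ = 0
  let P : MvPolynomial (Fin n) F := ∑ w ∈ s, α w • labelSum c w fun ks =>
    MvPolynomial.monomial (multidegree ks) (entryEval a p q (mon F (relabel w ks)))
  have hP : P = 0 := by
    refine MvPolynomial.funext fun t => ?_
    have h2 := entryEval_eq_zero (a := linComb a c t) (fun i g => Submodule.sum_mem _ fun k _ =>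
      Submodule.smul_mem _ _ (ha _ _)) h p q
    rw [map_zero, ← h2, map_sum, map_sum]
    refine Finset.sum_congr rfl fun w _ => ?_
    rw [MvPolynomial.smul_eval, map_smul, smul_eq_mul]
    congr 1
    refine (map_labelSum (c := c) (MvPolynomial.eval t).toAddMonoidHom w _).trans ?_
    have h3 : entryEval (linComb a c t) p q (mon F w) =
        (AddMonoidHom.mk' (fun A : UT F (2 * r) =>
          (A : Matrix (Fin (2 * r)) (Fin (2 * r)) F) p q) fun _ _ => rfl)
          (evalAt (symplectic F) (linComb a c t) (mon F w)) := rfl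
    rw [h3, evalAt_linComb, map_labelSum]
    refine labelSum_congr fun ks _ => ?_
    exact eval_monomial_multidegree t ks _
  have h1 := congrArg (MvPolynomial.coeff (multidegree (List.finRange n))) hP
  rw [MvPolynomial.coeff_zero] at h1
  rw [← h1, map_sum, MvPolynomial.coeff_sum]
  refine Finset.sum_congr rfl fun w _ => ?_
  rw [map_smul, MvPolynomial.coeff_smul, polarize]
  congr 1
  refine (map_labelSum (c := c) (entryEval a p q).toAddMonoidHom w _).trans (Eq.trans ?_
    (map_labelSum (c := c) (MvPolynomial.lcoeff F _).toAddMonoidHom w _).symm)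
  refine labelSum_congr fun ks _ => ?_
  simp only [LinearMap.toAddMonoidHom_coe, MvPolynomial.lcoeff_apply, MvPolynomial.coeff_monomial]
  split_ifs
  · rfl
  · exact map_zero _

end Evaluation

/-- The substitution that restores the labels. -/
noncomputable def unlabel (F : Type*) [Field F] {r n : ℕ} (c : Fin n → ℕ × (Fin r → ℤ)) (i : ℕ)
    (g : Fin r → ℤ) : FreeAlgebra F (Letter (Fin r → ℤ)) :=
  ∑ k : Fin n, if k.val + 1 = i ∧ (c k).2 = g then x F (c k).1 g else 0

theorem unlabel_mem (i : ℕ) (g : Fin r → ℤ) : unlabel F c i g ∈ freeComp F g := by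
  refine Submodule.sum_mem _ fun k _ => ?_
  split_ifs
  · exact ι_mem_freeComp ⟨_, g, false⟩
  · exact Submodule.zero_mem _

theorem unlabel_apply (k : Fin n) : unlabel F c (k.val + 1) (c k).2 = x F (c k).1 (c k).2 := by
  rw [unlabel, Finset.sum_eq_single k, if_pos ⟨rfl, rfl⟩]
  · intro k' _ hne
    rw [if_neg]
    rintro ⟨h, -⟩
    exact hne (Fin.ext (by omega))
  · simp

theorem subst_unlabel {w : List (Letter (Fin r → ℤ))} {ks : List (Fin n)}
    (h : ks.map c = w.map Letter.label) :
    subst (unlabel F c) (mon F (relabel w ks)) = mon F w := by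
  induction w generalizing ks with
  | nil => simp [relabel]
  | cons l w ih =>
    cases ks with
    | nil => simp at h
    | cons k ks =>
      rw [List.map_cons, List.map_cons, List.cons.injEq] at h
      have h3 : relabel (l :: w) (k :: ks) = ⟨k.val + 1, l.deg, l.starred⟩ :: relabel w ks := rfl
      rw [h3, mon_cons, map_mul, ih h.2, mon_cons]
      congr 1
      obtain ⟨i, g, s⟩ := l
      have h4 : c k = (i, g) := h.1
      have h5 := unlabel_apply (F := F) (c := c) k
      rw [h4] at h5
      rw [subst_ι]
      cases s
      · exact h5
      · change freeInv F (unlabel F c (k.val + 1) g) = _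
        rw [h5]
        exact freeInv_ι _

open Classical in
/-- The number of the linearizations of a word. -/
noncomputable def labelCount (c : Fin n → ℕ × (Fin r → ℤ)) (w : List (Letter (Fin r → ℤ))) : ℕ :=
  labelSum c w fun ks => if multidegree ks = multidegree (List.finRange n) then 1 else 0

/-- Every linearization of w returns to w when the labels are restored, so only their number
remains. -/
theorem subst_polarize (w : List (Letter (Fin r → ℤ))) :
    subst (unlabel F c) (polarize F c w) = (labelCount c w : F) • mon F w := by
  classical
  have h1 := map_labelSum (c := c) (subst (unlabel F c)).toLinearMap.toAddMonoidHom w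
    fun ks => if multidegree ks = multidegree (List.finRange n) then mon F (relabel w ks) else 0
  have h2 := map_labelSum (c := c) ((AddMonoidHom.mk' (fun a : F => a • mon F w)
    fun a b => add_smul a b _).comp (Nat.castAddMonoidHom F)) w
    fun ks => if multidegree ks = multidegree (List.finRange n) then 1 else 0
  refine h1.trans (Eq.trans ?_ h2.symm)
  refine labelSum_congr fun ks hks => ?_
  change subst (unlabel F c) (if _ then _ else _) = ((if _ then 1 else 0 : ℕ) : F) • mon F w
  split_ifs
  · rw [subst_unlabel hks, Nat.cast_one, one_smul]
  · rw [map_zero, Nat.cast_zero, zero_smul]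

theorem labelCount_pos (w : List (Letter (Fin r → ℤ))) :
    0 < labelCount (fun k : Fin w.length => w[k].label) w := by
  classical
  have h : (List.finRange w.length).map (fun k => w[k].label) = w.map Letter.label := by
    refine List.ext_getElem (by simp) ?_
    intro i h1 h2
    simp
  have := le_labelSum (c := fun k : Fin w.length => w[k].label) (φ := fun ks =>
    if multidegree ks = multidegree (List.finRange w.length) then 1 else 0) h
  rw [if_pos rfl] at this
  exact this

/-- Induction on the support: polarizing along the labels of one word w₀, restoring the labels and
dividing by `labelCount` at w₀ gives an element of J with the same coefficient at w₀ and no new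
words. Subtracting it removes w₀, and no splitting into multihomogeneous components is needed. -/
theorem mem_of_multilinear_mem [CharZero F]
    {J : TwoSidedIdeal (FreeAlgebra F (Letter (Fin r → ℤ)))} (hJ : IsTIdeal F J)
    (hJT : ∀ f ∈ J, f ∈ sympIdentities F r)
    (hmul : ∀ n, ∀ f ∈ multilinearSpace F (Fin r → ℤ) n, f ∈ sympIdentities F r → f ∈ J)
    {f : FreeAlgebra F (Letter (Fin r → ℤ))} (hf : f ∈ sympIdentities F r) : f ∈ J := by
  classical
  have hmem : f ∈ Submodule.span F (Set.range (mon F (G := Fin r → ℤ))) := by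
    rw [span_mon]; trivial
  obtain ⟨l, rfl⟩ := (Finsupp.mem_span_range_iff_exists_finsupp (R := F)).mp hmem
  rw [Finsupp.sum] at hf ⊢
  generalize l.support = s at hf ⊢
  generalize hα : (fun w => l w) = α at hf ⊢
  have hα' : ∀ w, l w = α w := fun w => congrFun hα w
  simp only [hα'] at hf ⊢
  clear hα hα' hmem
  induction s using Finset.induction_on generalizing α with
  | empty => simp
  | insert w₀ s hw ih =>
    let c : Fin w₀.length → ℕ × (Fin r → ℤ) := fun k => w₀[k].label
    -- Characteristic zero makes the positive count invertible.
    have hN : (labelCount c w₀ : F) ≠ 0 := Nat.cast_ne_zero.mpr (labelCount_pos w₀).ne'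
    have h1 := hmul w₀.length _ (Submodule.sum_mem _ fun w _ =>
      Submodule.smul_mem _ (α w) (polarize_mem (F := F) (c := c) w)) (polarize_sum_mem hf)
    have h2 := smul_mem_twoSided J (labelCount c w₀ : F)⁻¹
      (hJ.2 _ (isGradedInvEnd_subst (unlabel_mem (c := c))) _ h1)
    rw [map_sum, Finset.smul_sum] at h2
    have h3 : ∑ w ∈ insert w₀ s, α w • mon F w -
        ∑ w ∈ insert w₀ s, (labelCount c w₀ : F)⁻¹ • subst (unlabel F c) (α w • polarize F c w) =
        ∑ w ∈ s, (α w - (labelCount c w₀ : F)⁻¹ * (α w * labelCount c w)) • mon F w := by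
      rw [← Finset.sum_sub_distrib, Finset.sum_insert hw]
      have h4 : ∀ w, α w • mon F w -
          (labelCount c w₀ : F)⁻¹ • subst (unlabel F c) (α w • polarize F c w) =
          (α w - (labelCount c w₀ : F)⁻¹ * (α w * labelCount c w)) • mon F w := by
        intro w
        rw [map_smul, subst_polarize, smul_smul, smul_smul, sub_smul, mul_assoc]
      simp only [h4]
      rw [mul_comm (α w₀), inv_mul_cancel_left₀ hN, sub_self, zero_smul, zero_add]
    have h5 := ih (fun w => α w - (labelCount c w₀ : F)⁻¹ * (α w * labelCount c w))
      (h3 ▸ Submodule.sub_mem _ hf (hJT _ h2))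
    rw [← h3] at h5
    have := J.add_mem h5 h2
    rwa [sub_add_cancel] at this

end Polarization

/-! ### Conclusion: every identity lies in each T-ideal containing the generators. -/

theorem isTIdeal_inf {F : Type*} [Field F] {G : Type} [AddCommGroup G]
    {I J : TwoSidedIdeal (FreeAlgebra F (Letter G))} (hI : IsTIdeal F I) (hJ : IsTIdeal F J) :
    IsTIdeal F (I ⊓ J) := by
  exact ⟨fun f hf => ⟨hI.1 f hf.1, hJ.1 f hf.2⟩,
    fun φ hφ f hf => ⟨hI.2 φ hφ f hf.1, hJ.2 φ hφ f hf.2⟩⟩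

theorem mem_of_mem_sympIdentities {F : Type*} [Field F] [CharZero F] {r : ℕ} (hr : 1 ≤ r)
    {J : TwoSidedIdeal (FreeAlgebra F (Letter (Fin r → ℤ)))} (hJ : IsTIdeal F J)
    (hb : ∀ f ∈ basicIdentities F r, f ∈ J) (hN : ∀ w ∈ monomialIdentities F r, mon F w ∈ J)
    {f : FreeAlgebra F (Letter (Fin r → ℤ))} (hf : f ∈ sympIdentities F r) : f ∈ J := by
  -- J may contain non-identities, whereas the reductions need a T-ideal of identities. The
  -- intersection with `sympIdeal` still contains all generators.
  have hK := isTIdeal_inf hJ (isTIdeal_sympIdeal (F := F) (r := r))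
  have hb' : ∀ f ∈ basicIdentities F r, f ∈ J ⊓ sympIdeal F r := fun f hf =>
    ⟨hb f hf, mem_sympIdeal.mpr (basicIdentities_subset hf)⟩
  have hN' : ∀ w ∈ monomialIdentities F r, mon F w ∈ J ⊓ sympIdeal F r := fun w hw =>
    ⟨hN w hw, mem_sympIdeal.mpr hw.1⟩
  have hle : ∀ f ∈ J ⊓ sympIdeal F r, f ∈ sympIdentities F r := fun f hf =>
    mem_sympIdeal.mp hf.2
  have hmem := mem_of_multilinear_mem hK hle (fun n f hf hfT => mem_of_mem_multilinearSpace hr hK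
    hb' (fun w hnd hw => mon_mem_of_mem_sympIdentities hK hb' hN' hnd hw) hle hf hfT) hf
  exact hmem.1

end GradedInvolution

theorem mainTheorem7 (F : Type*) [Field F] [CharZero F] (r : ℕ) (hr : 1 ≤ r) :
    (∃ N : Set (List (GradedInvolution.Letter (Fin r → ℤ))), N.Finite ∧
      (∀ w ∈ N, GradedInvolution.mon F w ∈ GradedInvolution.sympIdentities F r) ∧
      GradedInvolution.tIdealGen F
        ({GradedInvolution.x F 1 (0 : Fin r → ℤ) * GradedInvolution.x F 2 0 -
            GradedInvolution.x F 2 0 * GradedInvolution.x F 1 0} ∪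
          {f | ∃ g : Fin r → ℤ, Module.finrank F (GradedInvolution.finestComp F r g) = 1 ∧
            f = GradedInvolution.xs F 1 g + GradedInvolution.x F 1 g} ∪
          {f | ∃ g : Fin r → ℤ, GradedInvolution.finestComp F r g = ⊥ ∧
            f = GradedInvolution.x F 1 g} ∪
          GradedInvolution.mon F '' N) =
        (GradedInvolution.sympIdentities F r : Set _)) ∧
    ∀ n : ℕ, ∃ b : Module.Basis
        {w : List (GradedInvolution.Letter (Fin r → ℤ)) // GradedInvolution.IsGood F r n w} F
        (GradedInvolution.multilinearQuotient F r n),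
      ∀ w, b w = GradedInvolution.goodClass F w := by
  open GradedInvolution in
  refine ⟨⟨monomialIdentities F r, finite_monomialIdentities, fun w hw => hw.1, ?_⟩,
    exists_basis hr⟩
  have hT : ∀ f ∈ basicIdentities F r ∪ mon F '' monomialIdentities F r,
      f ∈ sympIdentities F r := by
    rintro f (hf | ⟨w, hw, rfl⟩)
    · exact basicIdentities_subset hf
    · exact hw.1
  refine Set.Subset.antisymm ?_ ?_
  · intro f hf
    exact mem_sympIdeal.mp (hf _ isTIdeal_sympIdeal fun p hp => mem_sympIdeal.mpr (hT p hp))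
  · intro f hf J hJ hS
    exact mem_of_mem_sympIdentities hr hJ (fun f hf => hS f (Or.inl hf))
      (fun w hw => hS _ (Or.inr ⟨w, hw, rfl⟩)) hf
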